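/- Let $r,\rho\ge 1$. Let $\mathcal E$ be an evolution equation $u_t=H(t,x,u_0,u_1,\dots,u_r)$ for $u=u(t,x)$, where $u_k=\partial^k u/\partial x^k$, $H$ is $C^\infty$ on an open set of $\mathbb R^{r+3}$ and $H_{u_r}$ is not identically zero. Let $Q=\eta(t,x,u_0,\dots,u_\rho)\,\partial_u$ be a $\rho$th-order evolution vector field in reduced form, i.e. $\eta$ is $C^\infty$ on an open set of $\mathbb R^{\rho+3}$ and is of maximal rank with respect to $u_\rho$: $\eta_{u_\rho}\ne0$ wherever $\eta=0$. Write $u_\alpha$, $\alpha=(\alpha_0,\alpha_1)$, for the jet coordinate $\partial^{|\alpha|}u/\partial t^{\alpha_0}\partial x^{\alpha_1}$ and $D_t$, $D_x$ for the total derivatives. Let $\mathcal M$ be the set of points of the jet space of order $r+\rho$, lying over the domains of $H$ and $\eta$, at which $D_t^{\alpha_0}D_x^{\alpha_1}(u_t-H)=0$ for $|\alpha|\le\rho$ and $D_x^k\eta=0$ for $0\le k\le r$. The equation $\mathcal E$ is *conditionally invariant* with respect to $Q$ if $Q_{(r)}(u_t-H)=0$ at every point of $\mathcal M$, where $Q_{(r)}=\sum_{|\alpha|\le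 r}(D_t^{\alpha_0}D_x^{\alpha_1}\eta)\,\partial_{u_\alpha}$. A (local) *ansatz* $u=F(t,x,\varphi^1(t),\dots,\varphi^\rho(t))$ is given by a $C^\infty$ function $F(t,x,\bar\varphi)$ on an open set $U\subset\mathbb R^{2+\rho}$ whose sections $\{x:(t,x,\bar\varphi)\in U\}$ are intervals (possibly empty), with $\det\Phi\ne0$ on $U$, where $\Phi=(\partial F_{a-1}/\partial\varphi^b)_{a,b=1}^{\rho}$ and $F_k=\partial^kF/\partial x^k$. It is *constructed with $Q$* if it locally represents the general solution of $\eta=0$, regarded as an ordinary differential equation in $x$ with parameter $t$, i.e. if on $U$ the point $(t,x,F_0,\dots,F_\rho)$ lies in the domain of $\eta$ and $\eta(t,x,F_0,\dots,F_\rho)=0$. It *can be substituted into $\mathcal E$* if $(t,x,F_0,\dots,F_r)$ lies in the domain of $H$ on $U$; it then *reduces* $\mathcal E$ if the functions $$G^a=\sum_{b=1}^{\rho}(\Phi^{-1})^{ab}\,\partial_x^{\,b-1}\bigl(H(t,x,F_0,\dots,F_r)-F_t\bigr),\qquad a=1,\dots,\rho,$$ do not depend on $x$, so that substitution of the ansatz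 into $\mathcal E$ gives the normal system $\varphi^a_t=G^a(t,\bar\varphi)$ of $\rho$ first-order ordinary differential equations in the new unknown functions $\varphi^1,\dots,\varphi^\rho$. It *passes through* a point of $\mathcal M$ if at some point of $U$ the values of $t,x,F_0,\dots,F_{r+\rho}$ are the coordinates $t,x,u_0,\dots,u_{r+\rho}$ of that point. **Theorem.** 1. $\mathcal E$ is conditionally invariant with respect to $Q$ if and only if through every point of $\mathcal M$ there passes an ansatz constructed with $Q$ that reduces $\mathcal E$. 2. $\mathcal E$ is conditionally invariant with respect to $Q$ if and only if every ansatz that is constructed with $Q$ and can be substituted into $\mathcal E$ reduces $\mathcal E$. 3. An ansatz that is constructed with $Q$ and can be substituted into $\mathcal E$ reduces $\mathcal E$ if and only if $Q_{(r)}(u_t-H)=0$ at all points of $\mathcal M$ through which it passes. -/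

import Mathlib

open scoped ContDiff

noncomputable section

namespace EvolutionReduction

/-! ### Jets of functions `u(t, x)` and total derivatives -/

/-- A point of the infinite jet space of real functions `u` of `(t, x)`. The coordinate `u i j`
stands for `∂^{i+j} u / ∂t^i ∂x^j`. A condition that involves only coordinates of order at most
`m` is the same as a condition on the jet space `J^m`, pulled back by the projection. -/
structure JetPoint where
  t : ℝ
  x : ℝ
  u : ℕ → ℕ → ℝ

/-- The space of the variables `(t, x, u_0, …, u_n)`, where `u_k` is the `k`th derivative of `u`
in `x`. -/
abbrev XJet (n : ℕ) : Type := ℝ × ℝ × (Fin (n + 1) → ℝ)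

/-- The variables `(t, x, u_0, …, u_n)` of a jet. -/
def JetPoint.xJet (z : JetPoint) (n : ℕ) : XJet n := (z.t, z.x, fun k => z.u 0 k)

/-- The jet obtained from `z` by giving the coordinate `u i j` the value `s`. -/
def JetPoint.setU (z : JetPoint) (i j : ℕ) (s : ℝ) : JetPoint :=
  { z with u := Function.update z.u i (Function.update (z.u i) j s) }

/-- `∂f/∂t` for a function `f` on the jet space. -/
def partialT (f : JetPoint → ℝ) (z : JetPoint) : ℝ := deriv (fun s => f { z with t := s }) z.t

/-- `∂f/∂x` for a function `f` on the jet space. -/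
def partialX (f : JetPoint → ℝ) (z : JetPoint) : ℝ := deriv (fun s => f { z with x := s }) z.x

/-- `∂f/∂u_{(i, j)}` for a function `f` on the jet space. -/
def partialU (i j : ℕ) (f : JetPoint → ℝ) (z : JetPoint) : ℝ :=
  deriv (fun s => f (z.setU i j s)) (z.u i j)

/-- The total derivative `D_t = ∂_t + ∑_α u_{α₀ + 1, α₁} ∂_{u_α}`. It is applied only to functions
of finitely many of the coordinates, for which the sum is finite. -/
def totalDt (f : JetPoint → ℝ) (z : JetPoint) : ℝ :=
  partialT f z + ∑ᶠ α : ℕ × ℕ, z.u (α.1 + 1) α.2 * partialU α.1 α.2 f z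

/-- The total derivative `D_x = ∂_x + ∑_α u_{α₀, α₁ + 1} ∂_{u_α}`. -/
def totalDx (f : JetPoint → ℝ) (z : JetPoint) : ℝ :=
  partialX f z + ∑ᶠ α : ℕ × ℕ, z.u α.1 (α.2 + 1) * partialU α.1 α.2 f z

/-- The value `Q_(n) f`, where `Q_(n) = ∑_{|α| ≤ n} (D_t^{α₀} D_x^{α₁} η) ∂_{u_α}` is the `n`th
prolongation of the vector field `Q = η ∂_u`. -/
def prolong (η : JetPoint → ℝ) (n : ℕ) (f : JetPoint → ℝ) (z : JetPoint) : ℝ :=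
  ∑ m ∈ Finset.range (n + 1), ∑ α ∈ Finset.HasAntidiagonal.antidiagonal m,
    (totalDt^[α.1] (totalDx^[α.2] η)) z * partialU α.1 α.2 f z

/-- `∂f/∂u_k` for a function `f` of `(t, x, u_0, …, u_n)`. -/
def XJet.partialU {n : ℕ} (k : Fin (n + 1)) (f : XJet n → ℝ) (p : XJet n) : ℝ :=
  deriv (fun s => f (p.1, p.2.1, Function.update p.2.2 k s)) (p.2.2 k)

/-! ### Evolution equations, vector fields and conditional invariance -/

/-- An evolution equation `u_t = H(t, x, u_0, …, u_r)` with `H` smooth on an open set and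
`H_{u_r}` not identically zero. -/
structure EvolutionEquation (r : ℕ) where
  domain : Set (XJet r)
  isOpen_domain : IsOpen domain
  H : XJet r → ℝ
  smooth : ContDiffOn ℝ ∞ H domain
  order_eq : ∃ p ∈ domain, XJet.partialU (Fin.last r) H p ≠ 0

/-- An evolution vector field `Q = η(t, x, u_0, …, u_ρ) ∂_u` of order `ρ` in reduced form: `η` is
smooth on an open set and of maximal rank in `u_ρ`, i.e. `η_{u_ρ} ≠ 0` wherever `η = 0`. -/
structure ReducedField (ρ : ℕ) where
  domain : Set (XJet ρ)
  isOpen_domain : IsOpen domain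
  η : XJet ρ → ℝ
  smooth : ContDiffOn ℝ ∞ η domain
  maxRank : ∀ p ∈ domain, η p = 0 → XJet.partialU (Fin.last ρ) η p ≠ 0

/-- The differential function `E = u_t - H`. -/
def EvolutionEquation.lhs {r : ℕ} (E : EvolutionEquation r) (z : JetPoint) : ℝ :=
  z.u 1 0 - E.H (z.xJet r)

/-- The characteristic `η` of `Q` as a differential function. -/
def ReducedField.charFun {ρ : ℕ} (Q : ReducedField ρ) (z : JetPoint) : ℝ := Q.η (z.xJet ρ)

/-- The manifold that the differential consequences of `E` determine in the jet space of
order `r + n`. -/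
def EvolutionEquation.manifold {r : ℕ} (E : EvolutionEquation r) (n : ℕ) : Set JetPoint :=
  {z | z.xJet r ∈ E.domain ∧ ∀ i j, i + j ≤ n → (totalDt^[i] (totalDx^[j] E.lhs)) z = 0}

/-- The manifold that the differential consequences of `η = 0` with respect to `x` determine in
the jet space of order `ρ + n`. -/
def ReducedField.manifold {ρ : ℕ} (Q : ReducedField ρ) (n : ℕ) : Set JetPoint :=
  {z | z.xJet ρ ∈ Q.domain ∧ ∀ k ≤ n, (totalDx^[k] Q.charFun) z = 0}

/-- The intersection, in the jet space of order `r + ρ`, of the manifold of all differential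
consequences of `E` with the manifold of the `x`-consequences of `η = 0`. -/
def jointManifold {r ρ : ℕ} (E : EvolutionEquation r) (Q : ReducedField ρ) : Set JetPoint :=
  E.manifold ρ ∩ Q.manifold r

/-- `Q_(r) (u_t - H) = 0` at the jet `z`. -/
def InvariantAt {r ρ : ℕ} (E : EvolutionEquation r) (Q : ReducedField ρ) (z : JetPoint) : Prop :=
  prolong Q.charFun r E.lhs z = 0

/-- Conditional invariance of `E` with respect to `Q`: `Q_(r) (u_t - H)` vanishes on the joint
manifold. -/
def ConditionallyInvariant {r ρ : ℕ} (E : EvolutionEquation r) (Q : ReducedField ρ) : Prop :=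
  ∀ z ∈ jointManifold E Q, InvariantAt E Q z

/-! ### Ansatzes and reduction -/

/-- `F_k = ∂^k F / ∂x^k` for a function `F` of `(t, x, φ)`. -/
def xDeriv {ρ : ℕ} (k : ℕ) (F : ℝ × ℝ × (Fin ρ → ℝ) → ℝ) (p : ℝ × ℝ × (Fin ρ → ℝ)) : ℝ :=
  iteratedDeriv k (fun x => F (p.1, x, p.2.2)) p.2.1

/-- `∂F/∂t` for a function `F` of `(t, x, φ)`. -/
def tDeriv {ρ : ℕ} (F : ℝ × ℝ × (Fin ρ → ℝ) → ℝ) (p : ℝ × ℝ × (Fin ρ → ℝ)) : ℝ :=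
  deriv (fun t => F (t, p.2.1, p.2.2)) p.1

/-- `∂F/∂φ^b` for a function `F` of `(t, x, φ)`. -/
def phiDeriv {ρ : ℕ} (b : Fin ρ) (F : ℝ × ℝ × (Fin ρ → ℝ) → ℝ)
    (p : ℝ × ℝ × (Fin ρ → ℝ)) : ℝ :=
  deriv (fun s => F (p.1, p.2.1, Function.update p.2.2 b s)) (p.2.2 b)

/-- `(t, x, F_0, …, F_n)` at a point `(t, x, φ)`. -/
def xJetOf {ρ : ℕ} (n : ℕ) (F : ℝ × ℝ × (Fin ρ → ℝ) → ℝ) (p : ℝ × ℝ × (Fin ρ → ℝ)) : XJet n :=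
  (p.1, p.2.1, fun k => xDeriv k F p)

/-- The matrix `Φ = ∂(F_0, …, F_{ρ-1}) / ∂(φ^1, …, φ^ρ)`. -/
def PhiMatrix {ρ : ℕ} (F : ℝ × ℝ × (Fin ρ → ℝ) → ℝ) (p : ℝ × ℝ × (Fin ρ → ℝ)) :
    Matrix (Fin ρ) (Fin ρ) ℝ :=
  Matrix.of fun a b => phiDeriv b (xDeriv a F) p

/-- A (local) ansatz `u = F(t, x, φ^1(t), …, φ^ρ(t))`: `F` is smooth on an open set of points
`(t, x, φ)` whose sections by fixed `(t, φ)` are intervals in `x`, and `det Φ ≠ 0` there. -/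
structure Ansatz (ρ : ℕ) where
  domain : Set (ℝ × ℝ × (Fin ρ → ℝ))
  isOpen_domain : IsOpen domain
  ordConnected : ∀ (t : ℝ) (φ : Fin ρ → ℝ), {x : ℝ | (t, x, φ) ∈ domain}.OrdConnected
  F : ℝ × ℝ × (Fin ρ → ℝ) → ℝ
  smooth : ContDiffOn ℝ ∞ F domain
  det_ne_zero : ∀ p ∈ domain, (PhiMatrix F p).det ≠ 0

namespace Ansatz

variable {r ρ : ℕ}

/-- The ansatz is constructed with `Q`: for fixed `t`, it represents the (local) general
solution of the `ρ`th-order ordinary differential equation `η = 0` in `x`. That it satisfies the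
equation is required here; that the `ρ` parameters are the full number of essential ones is the
condition `det Φ ≠ 0`. -/
def ConstructedWith (A : Ansatz ρ) (Q : ReducedField ρ) : Prop :=
  ∀ p ∈ A.domain, xJetOf ρ A.F p ∈ Q.domain ∧ Q.η (xJetOf ρ A.F p) = 0

/-- The ansatz can be substituted into `E`: its jets lie in the domain of `H`. -/
def SubstitutableIn (A : Ansatz ρ) (E : EvolutionEquation r) : Prop :=
  ∀ p ∈ A.domain, xJetOf r A.F p ∈ E.domain

/-- The result `H(t, x, F_0, …, F_r)` of the substitution into the right-hand side of `E`. -/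
def substH (A : Ansatz ρ) (E : EvolutionEquation r) (p : ℝ × ℝ × (Fin ρ → ℝ)) : ℝ :=
  E.H (xJetOf r A.F p)

/-- The functions `G^a = ∑_b (Φ⁻¹)^{ab} ∂_x^{b-1} (H(t, x, F_0, …, F_r) - F_t)`, obtained by
solving for `φ_t` the system of the derivatives in `x` of orders `0, …, ρ-1` of the equation
`F_t + ∑_a F_{φ^a} φ^a_t = H(t, x, F_0, …, F_r)`. -/
def G (A : Ansatz ρ) (E : EvolutionEquation r) (p : ℝ × ℝ × (Fin ρ → ℝ)) : Fin ρ → ℝ :=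
  (PhiMatrix A.F p)⁻¹.mulVec fun b => xDeriv b (fun q => A.substH E q - tDeriv A.F q) p

/-- The ansatz reduces `E`: all its jets lie in the domain of `H` and the functions `G^a` do not
depend on `x`, so that `φ^a_t = G^a(t, φ)` is a normal system of `ρ` first-order ordinary
differential equations in `φ^1, …, φ^ρ`. -/
def Reduces (A : Ansatz ρ) (E : EvolutionEquation r) : Prop :=
  A.SubstitutableIn E ∧
    ∃ g : ℝ → (Fin ρ → ℝ) → (Fin ρ → ℝ),
      ∀ (t x : ℝ) (φ : Fin ρ → ℝ), (t, x, φ) ∈ A.domain → A.G E (t, x, φ) = g t φ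

/-- The ansatz passes through the jet `z`: at some point `(t, x, φ)` of its domain the values
of `t, x, F_0, …, F_m` are those of the variables `t, x, u_0, …, u_m` at `z`. -/
def PassesThrough (A : Ansatz ρ) (m : ℕ) (z : JetPoint) : Prop :=
  ∃ p ∈ A.domain, xJetOf m A.F p = z.xJet m

end Ansatz

end EvolutionReduction

end

/-! Both sides of the theorem are the same linear equation in `x`, read at a jet and along an
ansatz. On the manifold of `Q` every term of `Q_(r)(u_t - H)` vanishes except `D_t η`, and on the
manifold of the equation `u_{1,k} = D_x^k H`, so invariance at a point says `η_t + Σ η_{u_k} D_x^k H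
= 0` (`invariantAt_iff`). Differentiating `η(t, x, F_0, …, F_ρ) = 0` in `t` gives `η_t + Σ η_{u_k}
∂_x^k F_t = 0`. The difference is `Σ η_{u_k} ∂_x^k W = 0` with the defect `W = H - F_t`
(`Ansatz.linearizedDefect_eq`): the defect solves the linearization of `η = 0` along the ansatz.

Differentiating `η = 0` in `φ^a` shows that the functions `F_{φ^a}` solve this linear equation as
well. They form a fundamental system, since their Wronski matrix `Φ` is invertible and the leading
coefficient `η_{u_ρ}` is nonzero. The `G^a` are the coefficients that variation of constants assigns
to `W` in this system, so `W` is a solution exactly when they have zero `x`-derivative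
(`variation_of_constants`), and on intervals this means independence of `x`. With the fact that each
jet of an ansatz extends to a point of the joint manifold, this is the third statement
(`Ansatz.reduces_iff`).

The first two statements follow once an ansatz passes through every point of the joint manifold
(`exists_ansatz`). Near the point, `η = 0` is solved for `u_ρ`, and the resulting ordinary
differential equation is integrated with the initial values at a fixed `x` as parameters. The
consequences `D_x^k η = 0` then force the higher derivatives to agree with the given jet. Smoothness
of the ansatz needs a flow that is smooth in time and initial value
(`SmoothFlow.exists_contDiffOn_flow`), obtained by applying the implicit function theorem to the
Picard operator on a space of curves. -/

/-! ### Smooth dependence of local flows on initial values -/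

noncomputable section

namespace SmoothFlow

open Set Filter Topology

section ImplicitFunction

variable {E₁ E₂ F : Type*} [NormedAddCommGroup E₁] [NormedSpace ℝ E₁] [CompleteSpace E₁]
  [NormedAddCommGroup E₂] [NormedSpace ℝ E₂] [CompleteSpace E₂]
  [NormedAddCommGroup F] [NormedSpace ℝ F] [CompleteSpace F]

/-- A continuous solution of an implicit equation is as smooth as the equation. -/
theorem contDiffAt_of_implicit {n : WithTop ℕ∞} {f : E₁ × E₂ → F} {ψ : E₁ → E₂} {a : E₁}
    (hf : ContDiffAt ℝ n f (a, ψ a)) (hn : n ≠ 0)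
    (hinv : (fderiv ℝ f (a, ψ a) ∘L .inr ℝ E₁ E₂).IsInvertible) (hψ : ContinuousAt ψ a)
    (h : ∀ᶠ y in 𝓝 a, f (y, ψ y) = f (a, ψ a)) : ContDiffAt ℝ n ψ a := by
  have h1 := hf.contDiffAt_implicitFunction hn hinv
  refine h1.congr_of_eventuallyEq ?_
  have h2 := hf.eventually_apply_eq_iff_implicitFunction hn hinv
  have h3 : Tendsto (fun y => (y, ψ y)) (𝓝 a) (𝓝 (a, ψ a)) :=
    (continuousAt_id.prodMk hψ)
  filter_upwards [h3.eventually h2, h] with y hy hy'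
  exact (hy.1 hy').symm

end ImplicitFunction

/-! ### Smoothness of composition operators on spaces of continuous functions -/

section Nemytskii

variable {K : Type*} [TopologicalSpace K] [CompactSpace K]

/-- Pointwise application of a family of operators to a family of vectors. -/
def pointwiseApply (K : Type*) [TopologicalSpace K] [CompactSpace K]
    (E F : Type*) [NormedAddCommGroup E] [NormedSpace ℝ E] [NormedAddCommGroup F]
    [NormedSpace ℝ F] : C(K, E →L[ℝ] F) →L[ℝ] C(K, E) →L[ℝ] C(K, F) :=
  LinearMap.mkContinuous₂
    (LinearMap.mk₂ ℝ (fun (A : C(K, E →L[ℝ] F)) (h : C(K, E)) =>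
        (⟨fun x => A x (h x), A.continuous.clm_apply h.continuous⟩ : C(K, F)))
      (fun _ _ _ => by ext; simp) (fun _ _ _ => by ext; simp)
      (fun _ _ _ => by ext; simp) (fun _ _ _ => by ext; simp)) 1
    (fun A h => by
      rw [ContinuousMap.norm_le _ (by positivity)]
      intro x
      rw [one_mul]
      exact ((A x).le_opNorm (h x)).trans
        (mul_le_mul (A.norm_coe_le_norm x) (h.norm_coe_le_norm x) (norm_nonneg _) (norm_nonneg A)))

variable {E F : Type*} [NormedAddCommGroup E] [NormedSpace ℝ E] [NormedAddCommGroup F]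
  [NormedSpace ℝ F]

@[simp] theorem pointwiseApply_apply (A : C(K, E →L[ℝ] F)) (h : C(K, E)) (x : K) :
    pointwiseApply K E F A h x = A x (h x) := rfl

/-- At each point of `K` the remainder is estimated by the mean value inequality on the segment from
`u x` to `u x + h x`. The bound is uniform in `x` because postcomposition with `f'` is continuous in
the sup norm; no compactness in `E` is needed. -/
theorem hasFDerivAt_postcomp (f : C(E, F)) (f' : C(E, E →L[ℝ] F))
    (hf : ∀ y, HasFDerivAt f (f' y) y) (u : C(K, E)) :
    HasFDerivAt (fun u : C(K, E) => f.comp u) (pointwiseApply K E F (f'.comp u)) u := by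
  rw [hasFDerivAt_iff_isLittleO_nhds_zero, Asymptotics.isLittleO_iff]
  intro ε hε
  have hcont : ∀ᶠ v : C(K, E) in 𝓝 u, dist (f'.comp v) (f'.comp u) < ε :=
    ((ContinuousMap.continuous_postcomp f').tendsto u).eventually
      (Metric.ball_mem_nhds (f'.comp u) hε)
  obtain ⟨δ, hδ, hball⟩ := Metric.eventually_nhds_iff.1 hcont
  filter_upwards [Metric.ball_mem_nhds (0 : C(K, E)) hδ] with h hh
  rw [mem_ball_zero_iff] at hh
  rw [ContinuousMap.norm_le _ (by positivity)]
  intro x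
  have key : ∀ y ∈ segment ℝ (u x) (u x + h x), ‖f' y - f' (u x)‖ ≤ ε := by
    intro y hy
    rw [segment_eq_image'] at hy
    obtain ⟨θ, hθ, rfl⟩ := hy
    have hd : dist (u + θ • h) u < δ := by
      rw [dist_eq_norm, add_sub_cancel_left, norm_smul, Real.norm_of_nonneg hθ.1]
      exact (mul_le_of_le_one_left (norm_nonneg _) hθ.2).trans_lt hh
    have := (ContinuousMap.dist_apply_le_dist x).trans (hball hd).le
    simpa [dist_eq_norm] using this
  have := (convex_segment (u x) (u x + h x)).norm_image_sub_le_of_norm_hasFDerivWithin_le'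
    (fun y _ => (hf y).hasFDerivWithinAt) key (left_mem_segment ℝ _ _) (right_mem_segment ℝ _ _)
  simp only [ContinuousMap.sub_apply, ContinuousMap.comp_apply, ContinuousMap.add_apply,
    pointwiseApply_apply]
  refine (by simpa using this : _ ≤ ε * ‖h x‖).trans ?_
  exact mul_le_mul_of_nonneg_left (h.norm_coe_le_norm x) hε.le

end Nemytskii

universe u

/-- The derivative of postcomposition with `f` is postcomposition with `fderiv ℝ f` followed by a
continuous linear map, so induction on `n` applies. The codomain changes from `F` to `E →L[ℝ] F` in
the step; hence `F` is quantified inside the induction and shares its universe with `E`. -/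
theorem contDiff_postcomp {K : Type*} [TopologicalSpace K] [CompactSpace K]
    {E : Type u} [NormedAddCommGroup E] [NormedSpace ℝ E] (n : ℕ) :
    ∀ {F : Type u} [NormedAddCommGroup F] [NormedSpace ℝ F] (f : C(E, F)),
      ContDiff ℝ n f → ContDiff ℝ n (fun u : C(K, E) => f.comp u) := by
  induction n with
  | zero =>
    intro F _ _ f _
    exact contDiff_zero.2 (ContinuousMap.continuous_postcomp f)
  | succ n ih =>
    intro F _ _ f hf
    push_cast at hf ⊢
    have h1 := contDiff_succ_iff_fderiv.1 hf
    have hd : ∀ u : C(K, E), HasFDerivAt (fun u : C(K, E) => f.comp u) _ u :=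
      hasFDerivAt_postcomp f ⟨fderiv ℝ f, h1.2.2.continuous⟩
        (fun y => (h1.1 y).hasFDerivAt)
    rw [contDiff_succ_iff_fderiv]
    refine ⟨fun u => (hd u).differentiableAt, by simp, ?_⟩
    have : fderiv ℝ (fun u : C(K, E) => f.comp u) = fun u =>
        pointwiseApply K E F ((⟨fderiv ℝ f, h1.2.2.continuous⟩ : C(E, E →L[ℝ] F)).comp u) :=
      funext fun u => (hd u).fderiv
    rw [this]
    exact (pointwiseApply K E F).contDiff.comp
      (ih (⟨fderiv ℝ f, h1.2.2.continuous⟩ : C(E, E →L[ℝ] F)) h1.2.2)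

section Primitive

variable {E : Type*} [NormedAddCommGroup E] [NormedSpace ℝ E]

/-- The time interval on which rescaled integral curves are considered. -/
abbrev TimeInterval : Type := Icc (-1 : ℝ) 1

theorem neg_one_le_one : (-1 : ℝ) ≤ 1 := by norm_num

/-- The extension of a curve on the time interval by constants. -/
def extend (u : C(TimeInterval, E)) : ℝ → E := IccExtend neg_one_le_one u

omit [NormedSpace ℝ E] in
theorem continuous_extend (u : C(TimeInterval, E)) : Continuous (extend u) :=
  u.continuous.Icc_extend'

omit [NormedSpace ℝ E] in
theorem extend_apply (u : C(TimeInterval, E)) (s : TimeInterval) : extend u s = u s :=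
  IccExtend_val _ _ _

omit [NormedSpace ℝ E] in
theorem norm_extend_le (u : C(TimeInterval, E)) (s : ℝ) : ‖extend u s‖ ≤ ‖u‖ :=
  u.norm_coe_le_norm _

/-- The primitive that vanishes at time `0`. -/
def primitive (E : Type*) [NormedAddCommGroup E] [NormedSpace ℝ E] :
    C(TimeInterval, E) →L[ℝ] C(TimeInterval, E) :=
  LinearMap.mkContinuous
    { toFun := fun u => ⟨fun s => ∫ σ in (0 : ℝ)..s, extend u σ,
        (intervalIntegral.continuous_primitive
          (fun a b => (continuous_extend u).intervalIntegrable a b) 0).comp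
          continuous_subtype_val⟩
      map_add' := fun u v => by
        ext s
        exact intervalIntegral.integral_add ((continuous_extend u).intervalIntegrable _ _)
          ((continuous_extend v).intervalIntegrable _ _)
      map_smul' := fun c u => by
        ext s
        exact intervalIntegral.integral_smul c _ } 1
    (fun u => by
      rw [ContinuousMap.norm_le _ (by positivity)]
      intro s
      have h := intervalIntegral.norm_integral_le_of_norm_le_const (a := 0) (b := (s : ℝ))
        (f := extend u) (fun σ _ => norm_extend_le u σ)
      refine h.trans ?_
      rw [one_mul, sub_zero]
      exact mul_le_of_le_one_right (norm_nonneg _) (abs_le.2 s.2))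

theorem norm_primitive_apply_le (u : C(TimeInterval, E)) : ‖primitive E u‖ ≤ ‖u‖ :=
  ((primitive E).le_of_opNorm_le (LinearMap.mkContinuous_norm_le _ zero_le_one _) u).trans_eq
    (one_mul _)

end Primitive

/-! ### Integral curves as fixed points of the Picard operator -/

section Flow

variable {E : Type*} [NormedAddCommGroup E] [NormedSpace ℝ E]

/-- The operator whose fixed points are the integral curves of `τ • V` with value `p.1` at time
`0`, where `τ = p.2`. -/
def picard (V : C(E, E)) (p : E × ℝ) (u : C(TimeInterval, E)) : C(TimeInterval, E) :=
  ContinuousMap.const _ p.1 + p.2 • primitive E (V.comp u)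

theorem picard_apply (V : C(E, E)) (p : E × ℝ) (u : C(TimeInterval, E)) (s : TimeInterval) :
    picard V p u s = p.1 + p.2 • ∫ σ in (0 : ℝ)..s, V (extend u σ) := rfl

omit [NormedSpace ℝ E] in
theorem norm_comp_sub_comp_le {V : C(E, E)} {L : NNReal} (hL : LipschitzWith L V)
    (u v : C(TimeInterval, E)) : ‖V.comp u - V.comp v‖ ≤ L * ‖u - v‖ := by
  rw [ContinuousMap.norm_le _ (by positivity)]
  intro s
  exact (hL.norm_sub_le (u s) (v s)).trans
    (mul_le_mul_of_nonneg_left ((u - v).norm_coe_le_norm s) L.2)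

/-- Integration from `0` over `[-1, 1]` has operator norm at most `1`, so only the factor `p.2` and
the Lipschitz constant of `V` remain. -/
theorem contractingWith_picard {V : C(E, E)} {L : NNReal} (hL : LipschitzWith L V) {p : E × ℝ}
    (hp : |p.2| * L < 1) : ContractingWith (‖p.2‖₊ * L) (picard V p) := by
  refine ⟨by exact_mod_cast hp, LipschitzWith.of_dist_le_mul fun u v => ?_⟩
  rw [dist_eq_norm, dist_eq_norm, picard, picard, add_sub_add_left_eq_sub, ← smul_sub, ← map_sub,
    norm_smul]
  push_cast
  rw [mul_assoc]
  exact mul_le_mul_of_nonneg_left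
    ((norm_primitive_apply_le _).trans (norm_comp_sub_comp_le hL u v)) (norm_nonneg _)

/-- Since curves are rescaled to a fixed interval, time enters only as the scalar factor `p.2`.
Smoothness in time and in the initial value are thereby obtained together. -/
theorem contDiff_picard {V : C(E, E)} (hV : ContDiff ℝ ∞ V) :
    ContDiff ℝ ∞ (fun q : (E × ℝ) × C(TimeInterval, E) => picard V q.1 q.2) := by
  have h1 : ContDiff ℝ ∞ (fun u : C(TimeInterval, E) => V.comp u) :=
    contDiff_infty.2 fun n => contDiff_postcomp n V (contDiff_infty.1 hV n)
  have h2 : ContDiff ℝ ∞ (fun y : E => (ContinuousMap.const TimeInterval y)) :=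
    (LinearMap.mkContinuous
      { toFun := fun y : E => ContinuousMap.const TimeInterval y
        map_add' := fun _ _ => rfl
        map_smul' := fun _ _ => rfl } 1 (fun y => by
          rw [ContinuousMap.norm_le _ (by positivity)]
          intro s
          exact (one_mul ‖y‖).ge)).contDiff
  have h3 : ContDiff ℝ ∞ (fun u : C(TimeInterval, E) => primitive E (V.comp u)) :=
    (primitive E).contDiff.comp h1
  exact (h2.comp (contDiff_fst.comp contDiff_fst)).add
    ((contDiff_snd.comp contDiff_fst).smul (h3.comp contDiff_snd))

variable [CompleteSpace E]

open Classical in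
/-- The integral curve of `p.2 • V` with value `p.1` at time `0`. -/
def curve (V : C(E, E)) (p : E × ℝ) : C(TimeInterval, E) :=
  if h : ∃ u, picard V p u = u then h.choose else 0

theorem picard_curve {V : C(E, E)} {L : NNReal} (hL : LipschitzWith L V) {p : E × ℝ}
    (hp : |p.2| * L < 1) : picard V p (curve V p) = curve V p := by
  have h : ∃ u, picard V p u = u :=
    ⟨_, (contractingWith_picard hL hp).fixedPoint_isFixedPt⟩
  rw [curve, dif_pos h]
  exact h.choose_spec

theorem eq_curve {V : C(E, E)} {L : NNReal} (hL : LipschitzWith L V) {p : E × ℝ}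
    (hp : |p.2| * L < 1) {u : C(TimeInterval, E)} (hu : picard V p u = u) : u = curve V p :=
  (contractingWith_picard hL hp).fixedPoint_unique' hu (picard_curve hL hp)

/-- The implicit function theorem applies to `u - picard V p u = 0`: the partial derivative in `u`
is `1 - T` with `‖T‖ < 1`, invertible by the Neumann series, because the Picard operator is a
contraction. Uniqueness of the fixed point identifies the implicit function with `curve V`. -/
theorem contDiffAt_curve {V : C(E, E)} {L : NNReal} (hV : ContDiff ℝ ∞ V)
    (hL : LipschitzWith L V) {p : E × ℝ} (hp : |p.2| * L < 1) :
    ContDiffAt ℝ ∞ (curve V) p := by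
  set f : (E × ℝ) × C(TimeInterval, E) → C(TimeInterval, E) := fun q => q.2 - picard V q.1 q.2
    with hf
  have hfs : ContDiff ℝ ∞ f := contDiff_snd.sub (contDiff_picard hV)
  have hfa : ContDiffAt ℝ ∞ f (p, curve V p) := hfs.contDiffAt
  have hinv : (fderiv ℝ f (p, curve V p) ∘L .inr ℝ (E × ℝ) C(TimeInterval, E)).IsInvertible := by
    have hd : HasFDerivAt (fun u => picard V p u)
        (fderiv ℝ (fun u => picard V p u) (curve V p)) (curve V p) :=
      (((contDiff_picard hV).comp (contDiff_const.prodMk contDiff_id)).differentiable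
        (by simp) (curve V p)).hasFDerivAt
    have hlt : ‖fderiv ℝ (fun u => picard V p u) (curve V p)‖ < 1 := by
      refine lt_of_le_of_lt
        (norm_fderiv_le_of_lipschitz ℝ (contractingWith_picard hL hp).2) ?_
      exact_mod_cast (contractingWith_picard hL hp).1
    have h1 : HasFDerivAt (fun u => f (p, u))
        (1 - fderiv ℝ (fun u => picard V p u) (curve V p)) (curve V p) :=
      (hasFDerivAt_id _).sub hd
    have h2 : HasFDerivAt (fun u => f (p, u))
        (fderiv ℝ f (p, curve V p) ∘L .inr ℝ (E × ℝ) C(TimeInterval, E)) (curve V p) :=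
      (hfs.differentiable (by simp) (p, curve V p)).hasFDerivAt.comp (curve V p)
        (hasFDerivAt_prodMk_right p (curve V p))
    rw [h2.unique h1]
    obtain ⟨w, hw⟩ := isUnit_one_sub_of_norm_lt_one
      (R := C(TimeInterval, E) →L[ℝ] C(TimeInterval, E)) hlt
    exact ⟨ContinuousLinearEquiv.ofUnit w, hw⟩
  have h0 : f (p, curve V p) = 0 := by simp [hf, picard_curve hL hp]
  refine (hfa.contDiffAt_implicitFunction (by simp) hinv).congr_of_eventuallyEq ?_
  have hev := hfa.eventually_apply_implicitFunction (by simp) hinv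
  have hopen : ∀ᶠ q : E × ℝ in 𝓝 p, |q.2| * L < 1 :=
    ContinuousAt.eventually_lt (by fun_prop) continuousAt_const hp
  filter_upwards [hev, hopen] with q hq hq'
  rw [h0] at hq
  exact (eq_curve hL hq' (sub_eq_zero.1 hq).symm).symm

/-- Slowing an integral curve of `τ • V` down by the factor `c` yields a fixed point for the speed
`c * τ`. Thus the value at rescaled time `1`, as a function of the speed, is an integral curve of
`V` in ordinary time. -/
theorem curve_eq_rescale {V : C(E, E)} {L : NNReal} (hL : LipschitzWith L V) {y : E} {τ : ℝ}
    (hp : |τ| * L < 1) (c : TimeInterval) :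
    curve V (y, τ) c = curve V (y, c * τ) ⟨1, by simp⟩ := by
  have hmem : ∀ s : TimeInterval, (c : ℝ) * s ∈ Icc (-1 : ℝ) 1 := fun s => by
    rw [mem_Icc, ← abs_le, abs_mul]
    exact mul_le_one₀ (abs_le.2 c.2) (abs_nonneg _) (abs_le.2 s.2)
  have hp' : |(c : ℝ) * τ| * L < 1 := by
    rw [abs_mul, mul_assoc]
    exact (mul_le_of_le_one_left (by positivity) (abs_le.2 c.2)).trans_lt hp
  let v : C(TimeInterval, E) := ⟨fun s => curve V (y, τ) ⟨c * s, hmem s⟩, by fun_prop⟩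
  have hv : picard V (y, (c : ℝ) * τ) v = v := by
    ext s
    have h1 : v s = picard V (y, τ) (curve V (y, τ)) ⟨c * s, hmem s⟩ := by
      rw [picard_curve hL hp]; rfl
    rw [h1, picard_apply, picard_apply]
    have h2 := intervalIntegral.smul_integral_comp_mul_left (a := 0) (b := (s : ℝ))
      (fun σ => V (extend (curve V (y, τ)) σ)) (c : ℝ)
    simp only [mul_zero] at h2
    rw [← h2, mul_comm, mul_smul]
    congr 3
    refine intervalIntegral.integral_congr fun σ hσ => ?_
    have hσ' : σ ∈ Icc (-1 : ℝ) 1 :=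
      (uIcc_subset_Icc (by simp) s.2) hσ
    have h3 := extend_apply v ⟨σ, hσ'⟩
    have h4 := extend_apply (curve V (y, τ)) ⟨c * σ, hmem ⟨σ, hσ'⟩⟩
    simp only at h3 h4 ⊢
    rw [h3, h4]
    rfl
  have := eq_curve hL (p := (y, (c : ℝ) * τ)) hp' hv
  rw [← this]
  simp [v]

theorem curve_zero {V : C(E, E)} {L : NNReal} (hL : LipschitzWith L V) (y : E)
    (s : TimeInterval) : curve V (y, 0) s = y := by
  rw [← picard_curve hL (p := (y, 0)) (by simp), picard_apply]
  simp

theorem hasDerivAt_curve {V : C(E, E)} {L : NNReal} (hL : LipschitzWith L V) (y : E) {τ : ℝ}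
    (hτ : |τ| < 1 / (L + 1)) :
    HasDerivAt (fun τ => curve V (y, τ) ⟨1, by simp⟩) (V (curve V (y, τ) ⟨1, by simp⟩)) τ := by
  -- All speeds near `τ` are read off the single curve of speed `T`, whose integral equation can be
  -- differentiated in its upper limit. The bound `1 / (L + 1)` keeps `|T| * L < 1` and also covers
  -- `L = 0`.
  obtain ⟨T, hT, hT'⟩ := exists_between hτ
  have hT0 : 0 < T := (abs_nonneg _).trans_lt hT
  have hTL : |T| * L < 1 := by
    rw [abs_of_pos hT0]
    rw [lt_div_iff₀ (by positivity)] at hT'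
    nlinarith
  have hmem : ∀ {σ : ℝ}, |σ| < T → σ / T ∈ Icc (-1 : ℝ) 1 := fun {σ} h => by
    rw [mem_Icc, ← abs_le, abs_div, abs_of_pos hT0]
    exact (div_le_one hT0).2 h.le
  have hcurve : ∀ {σ : ℝ} (h : |σ| < T),
      curve V (y, σ) ⟨1, by simp⟩ = curve V (y, T) ⟨σ / T, hmem h⟩ := fun {σ} h => by
    rw [curve_eq_rescale hL hTL]
    simp [div_mul_cancel₀ _ hT0.ne']
  have hEq : (fun σ => curve V (y, σ) ⟨1, by simp⟩) =ᶠ[𝓝 τ] fun σ =>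
      y + T • ∫ s in (0 : ℝ)..(σ / T), V (extend (curve V (y, T)) s) := by
    have : ∀ᶠ σ in 𝓝 τ, |σ| < T := ContinuousAt.eventually_lt (by fun_prop) continuousAt_const hT
    filter_upwards [this] with σ hσ
    rw [hcurve hσ]
    conv_lhs => rw [← picard_curve hL hTL]
    rfl
  refine HasDerivAt.congr_of_eventuallyEq ?_ hEq
  have hc : Continuous fun s => V (extend (curve V (y, T)) s) :=
    V.continuous.comp (continuous_extend _)
  have h1 := (intervalIntegral.integral_hasDerivAt_right (hc.intervalIntegrable 0 (τ / T))
    (hc.stronglyMeasurableAtFilter _ _) hc.continuousAt).scomp τ ((hasDerivAt_id τ).div_const T)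
  have h2 := (h1.const_smul T).const_add y
  convert! h2 using 1
  rw [smul_smul, mul_one_div_cancel hT0.ne', one_smul, hcurve hT]
  exact congrArg V (extend_apply (curve V (y, T)) ⟨τ / T, hmem hT⟩).symm

end Flow

/-- A smooth vector field has a local flow that is smooth in time and the initial value. -/
theorem exists_contDiffOn_flow {E : Type*} [NormedAddCommGroup E] [NormedSpace ℝ E]
    [FiniteDimensional ℝ E] {V : E → E} {s : Set E} {y₀ : E} (hs : s ∈ 𝓝 y₀)
    (hV : ContDiffOn ℝ ∞ V s) :
    ∃ ε > 0, ∃ Y : ℝ × E → E,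
      ContDiffOn ℝ ∞ Y (Metric.ball 0 ε ×ˢ Metric.ball y₀ ε) ∧
      (∀ y, Y (0, y) = y) ∧
      ∀ τ ∈ Metric.ball (0 : ℝ) ε, ∀ y ∈ Metric.ball y₀ ε,
        Y (τ, y) ∈ s ∧ HasDerivAt (fun τ => Y (τ, y)) (V (Y (τ, y))) τ := by
  have := FiniteDimensional.complete ℝ E
  obtain ⟨R, hR, hRs⟩ := Metric.mem_nhds_iff.1 hs
  -- The cutoff makes the field globally smooth with compact support, hence globally Lipschitz, and
  -- leaves it unchanged on the ball of radius `R / 4`, to which the flow is confined below.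
  let χ : ContDiffBump y₀ := ⟨R / 4, R / 2, by positivity, by linarith⟩
  have hW : ContDiff ℝ ∞ (fun y => χ y • V y) := by
    rw [contDiff_iff_contDiffAt]
    intro y
    by_cases hy : y ∈ Metric.ball y₀ R
    · exact χ.contDiffAt.smul ((hV.mono hRs).contDiffAt (Metric.isOpen_ball.mem_nhds hy))
    · have : (fun y => χ y • V y) =ᶠ[𝓝 y] fun _ => 0 := by
        have hy' : y ∈ (Metric.closedBall y₀ (R / 2))ᶜ := by
          simp only [Metric.mem_ball, mem_compl_iff, Metric.mem_closedBall, not_le, not_lt] at hy ⊢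
          linarith
        filter_upwards [Metric.isClosed_closedBall.isOpen_compl.mem_nhds hy'] with z hz
        rw [χ.zero_of_le_dist (by
          simp only [mem_compl_iff, Metric.mem_closedBall, not_le] at hz; exact hz.le), zero_smul]
      exact contDiffAt_const.congr_of_eventuallyEq this
  have hsupp : HasCompactSupport (fun y => χ y • V y) := χ.hasCompactSupport.smul_right
  obtain ⟨L, hL⟩ :=
    (hW.of_le (by norm_num : (1 : WithTop ℕ∞) ≤ ∞)).lipschitzWith_of_hasCompactSupport
      hsupp (by simp)
  let W : C(E, E) := ⟨fun y => χ y • V y, hW.continuous⟩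
  have hLW : LipschitzWith L W := hL
  have hsm : ∀ p : ℝ × E, |p.1| * L < 1 →
      ContDiffAt ℝ ∞ (fun p : ℝ × E => curve W (p.2, p.1) ⟨1, by simp⟩) p := fun p hp =>
    (ContinuousMap.evalCLM ℝ (⟨1, by simp⟩ : TimeInterval)).contDiff.contDiffAt.comp p
      ((contDiffAt_curve (V := W) hW hLW (p := (p.2, p.1)) hp).comp p
        (contDiffAt_snd.prodMk contDiffAt_fst))
  have hcont : ∀ᶠ p : ℝ × E in 𝓝 (0, y₀),
      curve W (p.2, p.1) ⟨1, by simp⟩ ∈ Metric.ball y₀ (R / 4) := by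
    refine (hsm (0, y₀) (by simp)).continuousAt.eventually_mem (Metric.isOpen_ball.mem_nhds ?_)
    simp only [curve_zero hLW, Metric.mem_ball, dist_self]
    positivity
  have hLe : ∀ {τ : ℝ}, |τ| < 1 / (L + 1) → |τ| * L < 1 := fun {τ} h => by
    rw [lt_div_iff₀ (by positivity)] at h
    nlinarith [abs_nonneg τ]
  have hsmall : ∀ᶠ p : ℝ × E in 𝓝 (0, y₀), |p.1| < 1 / (L + 1) := by
    refine ContinuousAt.eventually_lt (by fun_prop) continuousAt_const ?_
    simp only [abs_zero]; positivity
  obtain ⟨ε, hε, hball⟩ := Metric.eventually_nhds_iff_ball.1 (hcont.and hsmall)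
  have hball' : ∀ τ ∈ Metric.ball (0 : ℝ) ε, ∀ y ∈ Metric.ball y₀ ε,
      (τ, y) ∈ Metric.ball ((0 : ℝ), y₀) ε := fun τ hτ y hy => by
    rw [← ball_prod_same]; exact ⟨hτ, hy⟩
  refine ⟨ε, hε, fun p => curve W (p.2, p.1) ⟨1, by simp⟩, ?_, fun y => curve_zero hLW y _, ?_⟩
  · rintro ⟨τ, y⟩ ⟨hτ, hy⟩
    exact (hsm _ (hLe (hball _ (hball' τ hτ y hy)).2)).contDiffWithinAt
  · intro τ hτ y hy
    have h := hball _ (hball' τ hτ y hy)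
    have h1 : curve W (y, τ) ⟨1, by simp⟩ ∈ Metric.ball y₀ (R / 4) := h.1
    refine ⟨hRs (Metric.ball_subset_ball (by linarith) h1), ?_⟩
    have h2 := hasDerivAt_curve hLW y h.2
    have h3 : W (curve W (y, τ) ⟨1, by simp⟩) = V (curve W (y, τ) ⟨1, by simp⟩) := by
      change χ _ • V _ = V _
      rw [χ.one_of_mem_closedBall (Metric.ball_subset_closedBall h1), one_smul]
    rw [h3] at h2
    exact h2

end SmoothFlow

end

noncomputable section

namespace EvolutionReduction

open Set Filter Topology

/-! ### Total derivatives of functions of finitely many coordinates -/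

namespace XJet

variable {n : ℕ}

/-- The variables `(t, x, u_0, …, u_n)` of a jet of order `n + k`. -/
def truncate (n k : ℕ) (p : XJet (n + k)) : XJet n :=
  (p.1, p.2.1, fun j => p.2.2 ⟨j, by omega⟩)

/-- The total derivative in `x` of a function of `(t, x, u_0, …, u_n)`. -/
def totalDx (f : XJet n → ℝ) (p : XJet (n + 1)) : ℝ :=
  fderiv ℝ f (truncate n 1 p) (0, 1, fun k => p.2.2 k.succ)

/-- The iterated total derivative in `x` of a function of `(t, x, u_0, …, u_n)`. -/
def iterTotalDx (f : XJet n → ℝ) : (k : ℕ) → XJet (n + k) → ℝ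
  | 0 => f
  | k + 1 => totalDx (iterTotalDx f k)

theorem contDiff_truncate (n k : ℕ) : ContDiff ℝ ∞ (truncate n k) := by
  unfold truncate
  fun_prop

theorem isOpen_truncate_preimage {s : Set (XJet n)} (hs : IsOpen s) (k : ℕ) :
    IsOpen (truncate n k ⁻¹' s) :=
  hs.preimage (contDiff_truncate n k).continuous

theorem contDiffOn_totalDx {f : XJet n → ℝ} {s : Set (XJet n)} (hs : IsOpen s)
    (hf : ContDiffOn ℝ ∞ f s) : ContDiffOn ℝ ∞ (totalDx f) (truncate n 1 ⁻¹' s) := by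
  have h1 : ContDiffOn ℝ ∞ (fderiv ℝ f) s := hf.fderiv_of_isOpen hs (by simp)
  have h2 : ContDiffOn ℝ ∞ (fun p => fderiv ℝ f (truncate n 1 p)) (truncate n 1 ⁻¹' s) :=
    h1.comp (contDiff_truncate n 1).contDiffOn (mapsTo_preimage _ _)
  refine h2.clm_apply (ContDiff.contDiffOn ?_)
  fun_prop

theorem contDiffOn_iterTotalDx {f : XJet n → ℝ} {s : Set (XJet n)} (hs : IsOpen s)
    (hf : ContDiffOn ℝ ∞ f s) (k : ℕ) :
    ContDiffOn ℝ ∞ (iterTotalDx f k) (truncate n k ⁻¹' s) := by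
  induction k with
  | zero => exact hf
  | succ k ih => exact contDiffOn_totalDx (isOpen_truncate_preimage hs k) ih

theorem fderiv_apply (f : XJet n → ℝ) (p : XJet n) (a b : ℝ) (c : Fin (n + 1) → ℝ) :
    fderiv ℝ f p (a, b, c) = a * fderiv ℝ f p (1, 0, 0) + b * fderiv ℝ f p (0, 1, 0) +
      ∑ k, c k * fderiv ℝ f p (0, 0, Pi.single k 1) := by
  have h : ((a, b, c) : XJet n) = a • ((1, 0, 0) : XJet n) + b • ((0, 1, 0) : XJet n) +
      ∑ k, c k • ((0, 0, Pi.single k 1) : XJet n) := by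
    ext j
    · simp [Prod.fst_sum]
    · simp [Prod.fst_sum, Prod.snd_sum]
    · simp [Prod.snd_sum, Pi.single_apply]
  rw [h]
  simp only [map_add, map_sum, map_smul, smul_eq_mul]

theorem partialU_eq_fderiv {f : XJet n → ℝ} {p : XJet n} (hf : DifferentiableAt ℝ f p)
    (k : Fin (n + 1)) : partialU k f p = fderiv ℝ f p (0, 0, Pi.single k 1) := by
  have h1 : HasDerivAt (fun s => ((p.1, p.2.1, Function.update p.2.2 k s) : XJet n))
      (0, 0, Pi.single k 1) (p.2.2 k) :=
    (hasDerivAt_const _ _).prodMk ((hasDerivAt_const _ _).prodMk (hasDerivAt_update _ _ _))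
  have h2 : (p.1, p.2.1, Function.update p.2.2 k (p.2.2 k)) = p := by simp
  exact (HasFDerivAt.comp_hasDerivAt_of_eq (p.2.2 k) hf.hasFDerivAt h1 h2.symm).deriv

end XJet

section TotalDerivatives

variable {n : ℕ} {f : XJet n → ℝ} {s : Set (XJet n)} {g : JetPoint → ℝ} {z : JetPoint}

theorem xJet_setU (z : JetPoint) (k : Fin (n + 1)) (a : ℝ) :
    (z.setU 0 k a).xJet n = (z.t, z.x, Function.update (fun j : Fin (n + 1) => z.u 0 j) k a) := by
  simp only [JetPoint.xJet, JetPoint.setU, Function.update_self]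
  congr 2
  ext j
  by_cases h : j = k
  · subst h; simp
  · rw [Function.update_of_ne h, Function.update_of_ne (by simpa [Fin.ext_iff] using h)]

theorem xJet_setU_of_not_mem (z : JetPoint) {i j : ℕ} (h : ¬ (i = 0 ∧ j < n + 1)) (a : ℝ) :
    (z.setU i j a).xJet n = z.xJet n := by
  simp only [JetPoint.xJet, JetPoint.setU]
  congr 2
  ext k
  by_cases hi : 0 = i
  · subst hi
    have : (k : ℕ) ≠ j := by omega
    simp [this]
  · rw [Function.update_of_ne hi]

theorem deriv_eq_fderiv_of_line (hs : IsOpen s) (hf : ContDiffOn ℝ ∞ f s) {h : ℝ → ℝ}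
    {γ : ℝ → XJet n} {a : ℝ} {v p : XJet n} (hp : p ∈ s) (hγ : HasDerivAt γ v a) (hγa : p = γ a)
    (hh : ∀ b, γ b ∈ s → h b = f (γ b)) : deriv h a = fderiv ℝ f p v := by
  have h1 : h =ᶠ[𝓝 a] fun b => f (γ b) :=
    (hγ.continuousAt.eventually_mem (hs.mem_nhds (hγa ▸ hp))).mono hh
  have h2 : DifferentiableAt ℝ f p :=
    (hf.contDiffAt (hs.mem_nhds hp)).differentiableAt (by simp)
  rw [h1.deriv_eq]
  exact (h2.hasFDerivAt.comp_hasDerivAt_of_eq a hγ hγa).deriv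

theorem partialT_eq_fderiv (hs : IsOpen s) (hf : ContDiffOn ℝ ∞ f s)
    (hg : ∀ z : JetPoint, z.xJet n ∈ s → g z = f (z.xJet n)) (hz : z.xJet n ∈ s) :
    partialT g z = fderiv ℝ f (z.xJet n) (1, 0, 0) :=
  deriv_eq_fderiv_of_line (γ := fun b => (b, z.x, fun k => z.u 0 k)) hs hf hz
    ((hasDerivAt_id _).prodMk (hasDerivAt_const _ _)) rfl fun b hb => hg { z with t := b } hb

theorem partialX_eq_fderiv (hs : IsOpen s) (hf : ContDiffOn ℝ ∞ f s)
    (hg : ∀ z : JetPoint, z.xJet n ∈ s → g z = f (z.xJet n)) (hz : z.xJet n ∈ s) :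
    partialX g z = fderiv ℝ f (z.xJet n) (0, 1, 0) :=
  deriv_eq_fderiv_of_line (γ := fun b => (z.t, b, fun k => z.u 0 k)) hs hf hz
    ((hasDerivAt_const _ _).prodMk ((hasDerivAt_id _).prodMk (hasDerivAt_const _ _))) rfl
    fun b hb => hg { z with x := b } hb

theorem partialU_eq_fderiv (hs : IsOpen s) (hf : ContDiffOn ℝ ∞ f s)
    (hg : ∀ z : JetPoint, z.xJet n ∈ s → g z = f (z.xJet n)) (hz : z.xJet n ∈ s)
    (k : Fin (n + 1)) :
    partialU 0 k g z = fderiv ℝ f (z.xJet n) (0, 0, Pi.single k 1) :=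
  deriv_eq_fderiv_of_line
    (γ := fun b => (z.t, z.x, Function.update (fun j : Fin (n + 1) => z.u 0 j) k b)) hs hf hz
    ((hasDerivAt_const _ _).prodMk ((hasDerivAt_const _ _).prodMk (hasDerivAt_update _ _ _)))
    (by simp [JetPoint.xJet]) fun b hb => by
      rw [hg _ (by rwa [xJet_setU]), xJet_setU]

theorem partialU_eq_zero (hg : ∀ z : JetPoint, z.xJet n ∈ s → g z = f (z.xJet n))
    (hz : z.xJet n ∈ s) {i j : ℕ} (h : ¬ (i = 0 ∧ j < n + 1)) : partialU i j g z = 0 := by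
  have : (fun b => g (z.setU i j b)) = fun _ => f (z.xJet n) := by
    ext b
    rw [hg _ (by rwa [xJet_setU_of_not_mem z h]), xJet_setU_of_not_mem z h]
  rw [partialU, this, deriv_const]

theorem finsum_mul_partialU (hs : IsOpen s) (hf : ContDiffOn ℝ ∞ f s)
    (hg : ∀ z : JetPoint, z.xJet n ∈ s → g z = f (z.xJet n)) (hz : z.xJet n ∈ s)
    (c : ℕ × ℕ → ℝ) : ∑ᶠ α : ℕ × ℕ, c α * partialU α.1 α.2 g z =
      ∑ k : Fin (n + 1), c (0, k) * fderiv ℝ f (z.xJet n) (0, 0, Pi.single k 1) := by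
  rw [finsum_eq_sum_of_support_subset (s := Finset.univ.image fun k : Fin (n + 1) => (0, (k : ℕ))),
    Finset.sum_image fun a _ b _ h => by simpa [Fin.ext_iff] using h]
  · exact Finset.sum_congr rfl fun k _ => by rw [partialU_eq_fderiv hs hf hg hz]
  · intro α hα
    by_contra h
    refine hα ?_
    have : ¬ (α.1 = 0 ∧ α.2 < n + 1) := fun h' => h (by
      simp only [Finset.coe_image, Finset.coe_univ, image_univ, mem_range]
      exact ⟨⟨α.2, h'.2⟩, Prod.ext h'.1.symm rfl⟩)
    simp only [partialU_eq_zero hg hz this, mul_zero]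

theorem totalDx_eq (hs : IsOpen s) (hf : ContDiffOn ℝ ∞ f s)
    (hg : ∀ z : JetPoint, z.xJet n ∈ s → g z = f (z.xJet n)) (hz : z.xJet n ∈ s) :
    totalDx g z = XJet.totalDx f (z.xJet (n + 1)) := by
  rw [totalDx, finsum_mul_partialU hs hf hg hz, partialX_eq_fderiv hs hf hg hz]
  refine Eq.trans ?_ (XJet.fderiv_apply f (z.xJet n) 0 1 fun k => z.u 0 (k + 1)).symm
  rw [zero_mul, one_mul, zero_add]

theorem totalDt_eq (hs : IsOpen s) (hf : ContDiffOn ℝ ∞ f s)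
    (hg : ∀ z : JetPoint, z.xJet n ∈ s → g z = f (z.xJet n)) (hz : z.xJet n ∈ s) :
    totalDt g z = fderiv ℝ f (z.xJet n) (1, 0, fun k => z.u 1 k) := by
  rw [totalDt, finsum_mul_partialU hs hf hg hz, partialT_eq_fderiv hs hf hg hz]
  refine Eq.trans ?_ (XJet.fderiv_apply f (z.xJet n) 1 0 fun k => z.u 1 k).symm
  rw [zero_mul, one_mul, add_zero]

/-- Agreement is claimed only over the open set `s`: elsewhere `f` need not be differentiable, and
coordinatewise derivatives and `fderiv` may take unrelated default values. -/
theorem iterate_totalDx_eq (hs : IsOpen s) (hf : ContDiffOn ℝ ∞ f s)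
    (hg : ∀ z : JetPoint, z.xJet n ∈ s → g z = f (z.xJet n)) (k : ℕ) :
    ∀ z : JetPoint, z.xJet n ∈ s →
      (totalDx^[k] g) z = XJet.iterTotalDx f k (z.xJet (n + k)) := by
  induction k with
  | zero => exact hg
  | succ k ih =>
    intro z hz
    rw [Function.iterate_succ_apply']
    exact totalDx_eq (s := XJet.truncate n k ⁻¹' s) (XJet.isOpen_truncate_preimage hs k)
      (XJet.contDiffOn_iterTotalDx hs hf k) ih hz

end TotalDerivatives

/-! ### The manifold of an evolution equation -/

/-- A function on the jet space that depends on `t`, `x` and finitely many coordinates `u i j` with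
`i ≤ m` only. -/
def DependsOnRows (m : ℕ) (f : JetPoint → ℝ) : Prop :=
  ∃ N : ℕ, ∀ z z' : JetPoint, z.t = z'.t → z.x = z'.x →
    (∀ i ≤ m, ∀ j ≤ N, z.u i j = z'.u i j) → f z = f z'

theorem JetPoint.setU_u (z : JetPoint) (i j k l : ℕ) (a : ℝ) :
    (z.setU i j a).u k l = if k = i ∧ l = j then a else z.u k l := by
  simp only [JetPoint.setU, Function.update_apply]
  split_ifs <;> simp_all

namespace DependsOnRows

variable {m : ℕ} {f : JetPoint → ℝ}

theorem partialU_eq_zero_of_lt (hf : DependsOnRows m f) {i : ℕ} (hi : m < i) (j : ℕ)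
    (z : JetPoint) : partialU i j f z = 0 := by
  obtain ⟨N, hN⟩ := hf
  have : (fun a => f (z.setU i j a)) = fun _ => f z := by
    ext a
    refine hN _ _ rfl rfl fun k hk l _ => ?_
    rw [JetPoint.setU_u, if_neg (by omega)]
  rw [partialU, this, deriv_const]

theorem finite_support (hf : DependsOnRows m f) (z : JetPoint) (c : ℕ × ℕ → ℝ) :
    (Function.support fun α : ℕ × ℕ => c α * partialU α.1 α.2 f z).Finite := by
  obtain ⟨N, hN⟩ := hf
  refine ((finite_Iic m).prod (finite_Iic N)).subset fun α hα => ?_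
  by_contra h
  refine hα ?_
  have : (fun a => f (z.setU α.1 α.2 a)) = fun _ => f z := by
    ext a
    refine hN _ _ rfl rfl fun k hk l hl => ?_
    rw [JetPoint.setU_u, if_neg]
    rintro ⟨rfl, rfl⟩
    exact h ⟨hk, hl⟩
  simp only [partialU, this, deriv_const, mul_zero]

theorem partialU_congr {N : ℕ} (hN : ∀ z z' : JetPoint, z.t = z'.t → z.x = z'.x →
    (∀ i ≤ m, ∀ j ≤ N, z.u i j = z'.u i j) → f z = f z') {z z' : JetPoint} (ht : z.t = z'.t)
    (hx : z.x = z'.x) (hu : ∀ i ≤ m, ∀ j ≤ N, z.u i j = z'.u i j) (i j : ℕ) :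
    partialU i j f z = partialU i j f z' ∧ (¬ (i ≤ m ∧ j ≤ N) → partialU i j f z = 0) := by
  have h1 : ∀ a, f (z.setU i j a) = f (z'.setU i j a) := fun a =>
    hN _ _ ht hx fun k hk l hl => by
      rw [JetPoint.setU_u, JetPoint.setU_u, hu k hk l hl]
  by_cases h : i ≤ m ∧ j ≤ N
  · refine ⟨?_, fun h' => absurd h h'⟩
    rw [partialU, partialU, hu i h.1 j h.2]
    congr 1
    exact funext h1
  · have h2 : ∀ a, f (z.setU i j a) = f z := fun a => hN _ _ rfl rfl fun k hk l hl => by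
      rw [JetPoint.setU_u, if_neg]
      rintro ⟨rfl, rfl⟩
      exact h ⟨hk, hl⟩
    have h3 : (fun a => f (z'.setU i j a)) = fun _ => f z := by
      ext a; rw [← h1, h2]
    have h4 : (fun a => f (z.setU i j a)) = fun _ => f z := funext h2
    rw [partialU, partialU, h3, h4, deriv_const, deriv_const]
    exact ⟨rfl, fun _ => rfl⟩

theorem totalDx (hf : DependsOnRows m f) : DependsOnRows m (totalDx f) := by
  obtain ⟨N, hN⟩ := hf
  refine ⟨N + 1, fun z z' ht hx hu => ?_⟩
  have hu' : ∀ i ≤ m, ∀ j ≤ N, z.u i j = z'.u i j := fun i hi j hj => hu i hi j (by omega)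
  have h1 : partialX f z = partialX f z' := by
    rw [partialX, partialX, hx]
    congr 1
    exact funext fun a => hN _ _ ht rfl hu'
  rw [EvolutionReduction.totalDx, EvolutionReduction.totalDx, h1]
  congr 1
  refine finsum_congr fun α => ?_
  obtain ⟨h2, h3⟩ := partialU_congr hN ht hx hu' α.1 α.2
  by_cases h : α.1 ≤ m ∧ α.2 ≤ N
  · rw [h2, hu _ h.1 _ (by omega)]
  · rw [← h2, h3 h, mul_zero, mul_zero]

theorem totalDt (hf : DependsOnRows m f) : DependsOnRows (m + 1) (totalDt f) := by
  obtain ⟨N, hN⟩ := hf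
  refine ⟨N, fun z z' ht hx hu => ?_⟩
  have hu' : ∀ i ≤ m, ∀ j ≤ N, z.u i j = z'.u i j := fun i hi j hj => hu i (by omega) j hj
  have h1 : partialT f z = partialT f z' := by
    rw [partialT, partialT, ht]
    congr 1
    exact funext fun a => hN _ _ rfl hx hu'
  rw [EvolutionReduction.totalDt, EvolutionReduction.totalDt, h1]
  congr 1
  refine finsum_congr fun α => ?_
  obtain ⟨h2, h3⟩ := partialU_congr hN ht hx hu' α.1 α.2
  by_cases h : α.1 ≤ m ∧ α.2 ≤ N
  · rw [h2, hu _ (by omega) _ h.2]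
  · rw [← h2, h3 h, mul_zero, mul_zero]

/-- No smoothness of `f` is required: `f` does not involve row `i`, so along any coordinate line at
most one of `u i j` and `f` varies. This allows the mixed consequences of the equation to be
computed without differentiating `H` explicitly. -/
theorem partialU_coord_sub (hf : DependsOnRows m f) {i : ℕ} (hi : m < i) (j : ℕ) (k l : ℕ)
    (z : JetPoint) : partialU k l (fun z => z.u i j - f z) z =
      (if (k, l) = (i, j) then 1 else 0) - partialU k l f z := by
  split_ifs with h
  · obtain ⟨rfl, rfl⟩ := Prod.mk.inj h
    rw [hf.partialU_eq_zero_of_lt hi]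
    obtain ⟨N, hN⟩ := hf
    have h1 : (fun a => (z.setU k l a).u k l - f (z.setU k l a)) = fun a => a - f z := by
      ext a
      rw [JetPoint.setU_u, if_pos ⟨rfl, rfl⟩]
      congr 1
      refine hN _ _ rfl rfl fun k' hk' l' _ => ?_
      rw [JetPoint.setU_u, if_neg (by omega)]
    rw [partialU, h1]
    simp
  · have h1 : (fun a => (z.setU k l a).u i j - f (z.setU k l a)) =
        fun a => z.u i j - f (z.setU k l a) := by
      ext a
      rw [JetPoint.setU_u, if_neg]
      rintro ⟨rfl, rfl⟩
      exact h rfl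
    rw [partialU, h1, deriv_const_sub, zero_sub, partialU]

theorem finsum_coord_sub (hf : DependsOnRows m f) {i : ℕ} (hi : m < i) (j : ℕ) (c : ℕ × ℕ → ℝ)
    (z : JetPoint) :
    ∑ᶠ α : ℕ × ℕ, c α * partialU α.1 α.2 (fun z => z.u i j - f z) z =
      c (i, j) - ∑ᶠ α : ℕ × ℕ, c α * partialU α.1 α.2 f z := by
  have h1 : ∀ α : ℕ × ℕ, c α * (if α = (i, j) then (1 : ℝ) else 0) =
      if α = (i, j) then c (i, j) else 0 := by
    intro α
    split_ifs with h
    · rw [h, mul_one]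
    · rw [mul_zero]
  simp only [hf.partialU_coord_sub hi, mul_sub, h1]
  rw [finsum_sub_distrib _ (hf.finite_support z c)]
  · rw [finsum_eq_single _ (i, j) fun α hα => if_neg hα, if_pos rfl]
  · refine (finite_singleton (i, j)).subset fun α hα => ?_
    by_contra h
    exact hα (if_neg h)

theorem totalDx_coord_sub (hf : DependsOnRows m f) {i : ℕ} (hi : m < i) (j : ℕ) :
    EvolutionReduction.totalDx (fun z => z.u i j - f z) =
      fun z => z.u i (j + 1) - EvolutionReduction.totalDx f z := by
  ext z
  rw [EvolutionReduction.totalDx, hf.finsum_coord_sub hi, EvolutionReduction.totalDx, partialX,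
    partialX, deriv_const_sub]
  ring

theorem totalDt_coord_sub (hf : DependsOnRows m f) {i : ℕ} (hi : m < i) (j : ℕ) :
    EvolutionReduction.totalDt (fun z => z.u i j - f z) =
      fun z => z.u (i + 1) j - EvolutionReduction.totalDt f z := by
  ext z
  rw [EvolutionReduction.totalDt, hf.finsum_coord_sub hi, EvolutionReduction.totalDt, partialT,
    partialT, deriv_const_sub]
  ring

end DependsOnRows

/-! ### Solving the differential consequences for the derivatives involving `t` -/

namespace EvolutionEquation

variable {r : ℕ} (E : EvolutionEquation r)

/-- The right-hand side `H` as a differential function. -/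
def rhs (z : JetPoint) : ℝ := E.H (z.xJet r)

theorem dependsOnRows_iterate_totalDx_rhs (j : ℕ) : DependsOnRows 0 (totalDx^[j] E.rhs) := by
  induction j with
  | zero =>
    refine ⟨r, fun z z' ht hx hu => ?_⟩
    simp only [Function.iterate_zero, id, rhs, JetPoint.xJet]
    rw [ht, hx]
    congr 3
    exact funext fun k => hu 0 le_rfl k (by omega)
  | succ j ih =>
    rw [Function.iterate_succ_apply']
    exact ih.totalDx

theorem dependsOnRows_iterate_totalDt_rhs (i j : ℕ) :
    DependsOnRows i (totalDt^[i] (totalDx^[j] E.rhs)) := by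
  induction i with
  | zero => exact E.dependsOnRows_iterate_totalDx_rhs j
  | succ i ih =>
    rw [Function.iterate_succ_apply']
    exact ih.totalDt

theorem iterate_totalDx_lhs (j : ℕ) :
    totalDx^[j] E.lhs = fun z => z.u 1 j - (totalDx^[j] E.rhs) z := by
  induction j with
  | zero => rfl
  | succ j ih =>
    rw [Function.iterate_succ_apply', ih,
      (E.dependsOnRows_iterate_totalDx_rhs j).totalDx_coord_sub one_pos,
      Function.iterate_succ_apply' _ _ E.rhs]

theorem iterate_totalDt_lhs (i j : ℕ) : totalDt^[i] (totalDx^[j] E.lhs) =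
    fun z => z.u (i + 1) j - (totalDt^[i] (totalDx^[j] E.rhs)) z := by
  induction i with
  | zero => exact E.iterate_totalDx_lhs j
  | succ i ih =>
    rw [Function.iterate_succ_apply', ih,
      (E.dependsOnRows_iterate_totalDt_rhs i j).totalDt_coord_sub (Nat.lt_succ_self i),
      Function.iterate_succ_apply' _ _ (EvolutionReduction.totalDx^[j] E.rhs)]

/-- Successive solution of the differential consequences of `E` for the derivatives involving
`t`. -/
def solveRows (t x : ℝ) (v : ℕ → ℝ) : ℕ → ℕ → ℕ → ℝ
  | 0 => fun _ => v
  | i + 1 => Function.update (solveRows t x v i) (i + 1) fun j =>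
      (totalDt^[i] (totalDx^[j] E.rhs)) ⟨t, x, solveRows t x v i⟩

theorem solveRows_eq (t x : ℝ) (v : ℕ → ℝ) {i m : ℕ} (h : i ≤ m) :
    E.solveRows t x v m i = E.solveRows t x v i i := by
  induction m, h using Nat.le_induction with
  | base => rfl
  | succ m hm ih => rw [solveRows, Function.update_of_ne (by omega), ih]

/-- Every jet in `x` over the domain of `H` extends to a point of the manifold of `E`. -/
theorem exists_mem_manifold (n : ℕ) (t x : ℝ) (v : ℕ → ℝ)
    (h : ((t, x, fun k => v k) : XJet r) ∈ E.domain) :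
    ∃ z ∈ E.manifold n, z.t = t ∧ z.x = x ∧ z.u 0 = v := by
  refine ⟨⟨t, x, fun i => E.solveRows t x v i i⟩, ⟨h, fun i j _ => ?_⟩, rfl, rfl, rfl⟩
  rw [iterate_totalDt_lhs]
  change E.solveRows t x v (i + 1) (i + 1) j - _ = 0
  rw [solveRows, Function.update_self, sub_eq_zero]
  -- `D_t^i D_x^j H` involves only the rows up to `i`, and these are final at stage `i`.
  obtain ⟨N, hN⟩ := E.dependsOnRows_iterate_totalDt_rhs i j
  refine hN _ _ rfl rfl fun k hk l _ => ?_
  change E.solveRows t x v i k l = E.solveRows t x v k k l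
  rw [solveRows_eq E t x v hk]

theorem iterate_totalDx_rhs {z : JetPoint} (hz : z.xJet r ∈ E.domain) (k : ℕ) :
    (totalDx^[k] E.rhs) z = XJet.iterTotalDx E.H k (z.xJet (r + k)) :=
  iterate_totalDx_eq E.isOpen_domain E.smooth (fun _ _ => rfl) k z hz

theorem u_one_eq {n : ℕ} {z : JetPoint} (hz : z ∈ E.manifold n) {k : ℕ} (hk : k ≤ n) :
    z.u 1 k = XJet.iterTotalDx E.H k (z.xJet (r + k)) := by
  have h := hz.2 0 k (by omega)
  rw [iterate_totalDt_lhs, sub_eq_zero] at h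
  exact h.trans (E.iterate_totalDx_rhs hz.1 k)

end EvolutionEquation

theorem ReducedField.iterate_totalDx_charFun {ρ : ℕ} (Q : ReducedField ρ) {z : JetPoint}
    (hz : z.xJet ρ ∈ Q.domain) (k : ℕ) :
    (totalDx^[k] Q.charFun) z = XJet.iterTotalDx Q.η k (z.xJet (ρ + k)) :=
  iterate_totalDx_eq Q.isOpen_domain Q.smooth (fun _ _ => rfl) k z hz

theorem EvolutionEquation.partialU_lhs {r : ℕ} (E : EvolutionEquation r) {i : ℕ} (hi : i ≠ 0)
    (j : ℕ) (z : JetPoint) : partialU i j E.lhs z = if (i, j) = (1, 0) then 1 else 0 := by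
  have h := (E.dependsOnRows_iterate_totalDx_rhs 0).partialU_coord_sub one_pos 0 i j z
  rw [(E.dependsOnRows_iterate_totalDx_rhs 0).partialU_eq_zero_of_lt (Nat.pos_of_ne_zero hi),
    sub_zero] at h
  exact h

/-- On the manifold of `Q`, only the term with `∂/∂u_t` of the prolongation contributes. -/
theorem invariantAt_iff_totalDt {r ρ : ℕ} (hr : 1 ≤ r) (E : EvolutionEquation r)
    (Q : ReducedField ρ) {z : JetPoint} (hz : z ∈ Q.manifold r) :
    InvariantAt E Q z ↔ totalDt Q.charFun z = 0 := by
  have hterm : ∀ m ∈ Finset.range (r + 1), ∀ α ∈ Finset.HasAntidiagonal.antidiagonal m,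
      α ≠ ((1, 0) : ℕ × ℕ) →
      (totalDt^[α.1] (totalDx^[α.2] Q.charFun)) z * partialU α.1 α.2 E.lhs z = 0 := by
    rintro m hm ⟨i, j⟩ hα hne
    rw [Finset.HasAntidiagonal.mem_antidiagonal] at hα
    rw [Finset.mem_range] at hm
    -- Terms without `t`-derivatives carry a factor `D_x^j η`, zero for `j ≤ r`; among the other
    -- coordinates, `u_t - H` involves only `u_t`.
    by_cases hi : i = 0
    · subst hi
      have := hz.2 j (by simp at hα; omega)
      simp [this]
    · simp only
      rw [E.partialU_lhs hi, if_neg hne, mul_zero]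
  rw [InvariantAt, prolong, Finset.sum_eq_single_of_mem 1 (by simp; omega),
    Finset.sum_eq_single_of_mem (1, 0) (by simp)]
  · simp [E.partialU_lhs one_ne_zero]
  · exact fun α hα => hterm 1 (by simp; omega) α hα
  · intro m hm hm1
    refine Finset.sum_eq_zero fun α hα => hterm m hm α hα ?_
    rintro rfl
    simp at hα
    omega

/-- Invariance at a point of the joint manifold in terms of the variables `t, x, u_0, u_1, …`. -/
theorem invariantAt_iff {r ρ : ℕ} (hr : 1 ≤ r) (E : EvolutionEquation r)
    (Q : ReducedField ρ) {z : JetPoint} (hz : z ∈ jointManifold E Q) :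
    InvariantAt E Q z ↔ fderiv ℝ Q.η (z.xJet ρ)
      (1, 0, fun k => XJet.iterTotalDx E.H k (z.xJet (r + k))) = 0 := by
  rw [invariantAt_iff_totalDt hr E Q hz.2,
    totalDt_eq (g := Q.charFun) Q.isOpen_domain Q.smooth (fun _ _ => rfl) hz.2.1]
  have : (fun k : Fin (ρ + 1) => z.u 1 k) =
      fun k : Fin (ρ + 1) => XJet.iterTotalDx E.H k (z.xJet (r + k)) :=
    funext fun k => E.u_one_eq hz.1 (by omega)
  rw [this]

/-! ### Calculus of functions of `(t, x, φ)` -/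

section ParameterCalculus

variable {ρ : ℕ} {f g : ℝ × ℝ × (Fin ρ → ℝ) → ℝ} {U : Set (ℝ × ℝ × (Fin ρ → ℝ))}
  {p : ℝ × ℝ × (Fin ρ → ℝ)}

theorem hasFDerivAt_of_contDiffOn (hU : IsOpen U) (hf : ContDiffOn ℝ ∞ f U) (hp : p ∈ U) :
    HasFDerivAt f (fderiv ℝ f p) p :=
  ((hf.contDiffAt (hU.mem_nhds hp)).differentiableAt (by simp)).hasFDerivAt

theorem hasDerivAt_tLine (t : ℝ) (q : ℝ × (Fin ρ → ℝ)) :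
    HasDerivAt (fun s : ℝ => (s, q)) (1, 0) t :=
  (hasDerivAt_id _).prodMk (hasDerivAt_const _ _)

theorem hasDerivAt_xLine (t x : ℝ) (φ : Fin ρ → ℝ) :
    HasDerivAt (fun s : ℝ => (t, s, φ)) (0, 1, 0) x :=
  (hasDerivAt_const _ _).prodMk ((hasDerivAt_id _).prodMk (hasDerivAt_const _ _))

theorem hasDerivAt_phiLine (t x : ℝ) (φ : Fin ρ → ℝ) (b : Fin ρ) :
    HasDerivAt (fun s : ℝ => (t, x, Function.update φ b s)) (0, 0, Pi.single b 1) (φ b) :=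
  (hasDerivAt_const _ _).prodMk ((hasDerivAt_const _ _).prodMk (hasDerivAt_update _ _ _))

theorem tDeriv_eq_fderiv (hU : IsOpen U) (hf : ContDiffOn ℝ ∞ f U) (hp : p ∈ U) :
    tDeriv f p = fderiv ℝ f p (1, 0, 0) :=
  ((hasFDerivAt_of_contDiffOn hU hf hp).comp_hasDerivAt_of_eq p.1
    (hasDerivAt_tLine p.1 p.2) rfl).deriv

theorem phiDeriv_eq_fderiv (hU : IsOpen U) (hf : ContDiffOn ℝ ∞ f U) (hp : p ∈ U) (b : Fin ρ) :
    phiDeriv b f p = fderiv ℝ f p (0, 0, Pi.single b 1) :=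
  ((hasFDerivAt_of_contDiffOn hU hf hp).comp_hasDerivAt_of_eq (p.2.2 b)
    (hasDerivAt_phiLine p.1 p.2.1 p.2.2 b) (by simp)).deriv

theorem hasDerivAt_comp_xLine (hU : IsOpen U) (hf : ContDiffOn ℝ ∞ f U) {t x : ℝ}
    {φ : Fin ρ → ℝ} (hp : (t, x, φ) ∈ U) :
    HasDerivAt (fun s => f (t, s, φ)) (fderiv ℝ f (t, x, φ) (0, 1, 0)) x :=
  (hasFDerivAt_of_contDiffOn hU hf hp).comp_hasDerivAt_of_eq x (hasDerivAt_xLine t x φ) rfl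

theorem xDeriv_succ (k : ℕ) (f : ℝ × ℝ × (Fin ρ → ℝ) → ℝ) (p : ℝ × ℝ × (Fin ρ → ℝ)) :
    xDeriv (k + 1) f p = deriv (fun x => xDeriv k f (p.1, x, p.2.2)) p.2.1 := by
  simp only [xDeriv, iteratedDeriv_succ]

theorem contDiffOn_fderiv_apply (hU : IsOpen U) (hf : ContDiffOn ℝ ∞ f U)
    (v : ℝ × ℝ × (Fin ρ → ℝ)) : ContDiffOn ℝ ∞ (fun q => fderiv ℝ f q v) U :=
  (hf.fderiv_of_isOpen hU (by simp)).clm_apply contDiffOn_const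

theorem xDeriv_congr (hU : IsOpen U) (h : EqOn f g U) (k : ℕ) : 
    EqOn (xDeriv k f) (xDeriv k g) U := by
  induction k with
  | zero => intro p hp; simpa [xDeriv] using h hp
  | succ k ih =>
    intro p hp
    rw [xDeriv_succ, xDeriv_succ]
    refine Filter.EventuallyEq.deriv_eq ?_
    have : ∀ᶠ x in 𝓝 p.2.1, (p.1, x, p.2.2) ∈ U :=
      (hasDerivAt_xLine p.1 p.2.1 p.2.2).continuousAt.eventually_mem (hU.mem_nhds hp)
    exact this.mono fun x hx => ih hx

theorem xDeriv_succ_eq_fderiv_of_contDiffOn (hU : IsOpen U) {k : ℕ}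
    (hf : ContDiffOn ℝ ∞ (xDeriv k f) U) (hp : p ∈ U) :
    xDeriv (k + 1) f p = fderiv ℝ (xDeriv k f) p (0, 1, 0) := by
  rw [xDeriv_succ]
  exact (hasDerivAt_comp_xLine hU hf hp).deriv

theorem contDiffOn_xDeriv (hU : IsOpen U) (hf : ContDiffOn ℝ ∞ f U) (k : ℕ) :
    ContDiffOn ℝ ∞ (xDeriv k f) U := by
  induction k with
  | zero => exact hf.congr fun p _ => by simp [xDeriv]
  | succ k ih =>
    exact (contDiffOn_fderiv_apply hU ih (0, 1, 0)).congr fun p hp =>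
      xDeriv_succ_eq_fderiv_of_contDiffOn hU ih hp

theorem xDeriv_succ_eq_fderiv (hU : IsOpen U) (hf : ContDiffOn ℝ ∞ f U) (k : ℕ) (hp : p ∈ U) :
    xDeriv (k + 1) f p = fderiv ℝ (xDeriv k f) p (0, 1, 0) :=
  xDeriv_succ_eq_fderiv_of_contDiffOn hU (contDiffOn_xDeriv hU hf k) hp

theorem fderiv_fderiv_comm (hU : IsOpen U) (hf : ContDiffOn ℝ ∞ f U) (hp : p ∈ U)
    (v w : ℝ × ℝ × (Fin ρ → ℝ)) : fderiv ℝ (fun q => fderiv ℝ f q v) p w =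
      fderiv ℝ (fun q => fderiv ℝ f q w) p v := by
  have hd : DifferentiableAt ℝ (fderiv ℝ f) p :=
    ((hf.fderiv_of_isOpen (m := ∞) hU (by simp)).contDiffAt (hU.mem_nhds hp)).differentiableAt
      (by simp)
  have h : ∀ v w, fderiv ℝ (fun q => fderiv ℝ f q v) p w = fderiv ℝ (fderiv ℝ f) p w v := by
    intro v w
    rw [fderiv_clm_apply hd (differentiableAt_const v)]
    simp
  rw [h, h]
  exact (hf.contDiffAt (hU.mem_nhds hp)).isSymmSndFDerivAt
    (by simpa using WithTop.coe_le_coe.2 (le_top : (2 : ℕ∞) ≤ ⊤)) w v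

theorem fderiv_congr_of_eqOn (hU : IsOpen U) (h : EqOn f g U) (hp : p ∈ U) :
    fderiv ℝ f p = fderiv ℝ g p :=
  (h.eventuallyEq_of_mem (hU.mem_nhds hp)).fderiv_eq

theorem xDeriv_fderiv_apply (hU : IsOpen U) (hf : ContDiffOn ℝ ∞ f U)
    (v : ℝ × ℝ × (Fin ρ → ℝ)) (k : ℕ) :
    EqOn (xDeriv k fun q => fderiv ℝ f q v) (fun q => fderiv ℝ (xDeriv k f) q v) U := by
  induction k with
  | zero =>
    intro p hp
    have : xDeriv 0 f = f := by ext; simp [xDeriv]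
    simp [xDeriv, this]
  | succ k ih =>
    intro p hp
    rw [xDeriv_succ_eq_fderiv hU (contDiffOn_fderiv_apply hU hf v) k hp,
      fderiv_congr_of_eqOn hU ih hp, fderiv_fderiv_comm hU (contDiffOn_xDeriv hU hf k) hp]
    exact congrArg (fun L => L v)
      (fderiv_congr_of_eqOn hU (fun q hq => (xDeriv_succ_eq_fderiv hU hf k hq).symm) hp)

theorem xDeriv_tDeriv (hU : IsOpen U) (hf : ContDiffOn ℝ ∞ f U) (k : ℕ) (hp : p ∈ U) :
    xDeriv k (tDeriv f) p = fderiv ℝ (xDeriv k f) p (1, 0, 0) := by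
  rw [xDeriv_congr hU (fun q hq => tDeriv_eq_fderiv hU hf hq) k hp]
  exact xDeriv_fderiv_apply hU hf _ k hp

theorem contDiffOn_tDeriv (hU : IsOpen U) (hf : ContDiffOn ℝ ∞ f U) :
    ContDiffOn ℝ ∞ (tDeriv f) U :=
  (contDiffOn_fderiv_apply hU hf (1, 0, 0)).congr fun _ hq => tDeriv_eq_fderiv hU hf hq

theorem xDeriv_sub (hU : IsOpen U) (hf : ContDiffOn ℝ ∞ f U) (hg : ContDiffOn ℝ ∞ g U) (k : ℕ) :
    EqOn (xDeriv k fun q => f q - g q) (fun q => xDeriv k f q - xDeriv k g q) U := by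
  induction k with
  | zero => intro p _; simp [xDeriv]
  | succ k ih =>
    intro p hp
    rw [xDeriv_succ_eq_fderiv hU (hf.sub hg) k hp, fderiv_congr_of_eqOn hU ih hp]
    simp only
    rw [xDeriv_succ_eq_fderiv hU hf k hp, xDeriv_succ_eq_fderiv hU hg k hp]
    rw [((hasFDerivAt_of_contDiffOn hU (contDiffOn_xDeriv hU hf k) hp).fun_sub
      (hasFDerivAt_of_contDiffOn hU (contDiffOn_xDeriv hU hg k) hp)).fderiv]
    rfl

theorem xDeriv_zero_fun (k : ℕ) (p : ℝ × ℝ × (Fin ρ → ℝ)) :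
    xDeriv k (fun _ => (0 : ℝ)) p = 0 := by
  simp only [xDeriv]
  rw [iteratedDeriv_const]
  simp

/-! ### Substitution of jets of functions of `(t, x, φ)` -/

theorem contDiffOn_xJetOf (hU : IsOpen U) (hf : ContDiffOn ℝ ∞ f U) (n : ℕ) :
    ContDiffOn ℝ ∞ (xJetOf n f) U :=
  contDiffOn_fst.prodMk ((contDiff_fst.comp contDiff_snd).contDiffOn.prodMk
    (contDiffOn_pi.2 fun k => contDiffOn_xDeriv hU hf k))

variable {n : ℕ} {h : XJet n → ℝ} {s : Set (XJet n)}

theorem contDiffOn_comp_xJetOf (hU : IsOpen U) (hf : ContDiffOn ℝ ∞ f U)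
    (hh : ContDiffOn ℝ ∞ h s) (hUs : MapsTo (xJetOf n f) U s) :
    ContDiffOn ℝ ∞ (fun q => h (xJetOf n f q)) U :=
  hh.comp (contDiffOn_xJetOf hU hf n) hUs

theorem fderiv_comp_xJetOf (hU : IsOpen U) (hf : ContDiffOn ℝ ∞ f U) (hs : IsOpen s)
    (hh : ContDiffOn ℝ ∞ h s) (hUs : MapsTo (xJetOf n f) U s) (hp : p ∈ U)
    (v : ℝ × ℝ × (Fin ρ → ℝ)) : fderiv ℝ (fun q => h (xJetOf n f q)) p v =
      fderiv ℝ h (xJetOf n f p) (v.1, v.2.1, fun k => fderiv ℝ (xDeriv k f) p v) := by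
  have h1 : HasFDerivAt (xJetOf n f) ((ContinuousLinearMap.fst ℝ ℝ (ℝ × (Fin ρ → ℝ))).prod
      (((ContinuousLinearMap.fst ℝ ℝ (Fin ρ → ℝ)).comp
        (ContinuousLinearMap.snd ℝ ℝ (ℝ × (Fin ρ → ℝ)))).prod
      (ContinuousLinearMap.pi fun k : Fin (n + 1) => fderiv ℝ (xDeriv k f) p))) p :=
    hasFDerivAt_fst.prodMk ((hasFDerivAt_fst.comp p hasFDerivAt_snd).prodMk
      (hasFDerivAt_pi.2 fun k => hasFDerivAt_of_contDiffOn hU (contDiffOn_xDeriv hU hf k) hp))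
  have h2 : HasFDerivAt h (fderiv ℝ h (xJetOf n f p)) (xJetOf n f p) :=
    ((hh.contDiffAt (hs.mem_nhds (hUs hp))).differentiableAt (by simp)).hasFDerivAt
  have h3 : HasFDerivAt (fun q => h (xJetOf n f q)) _ p := h2.comp p h1
  rw [h3.fderiv]
  rfl

theorem fderiv_comp_xJetOf_x (hU : IsOpen U) (hf : ContDiffOn ℝ ∞ f U) (hs : IsOpen s)
    (hh : ContDiffOn ℝ ∞ h s) (hUs : MapsTo (xJetOf n f) U s) (hp : p ∈ U) :
    fderiv ℝ (fun q => h (xJetOf n f q)) p (0, 1, 0) =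
      XJet.totalDx h (xJetOf (n + 1) f p) := by
  rw [fderiv_comp_xJetOf hU hf hs hh hUs hp]
  have : (fun k : Fin (n + 1) => fderiv ℝ (xDeriv k f) p (0, 1, 0)) =
      fun k : Fin (n + 1) => xDeriv (k + 1) f p :=
    funext fun k => (xDeriv_succ_eq_fderiv hU hf k hp).symm
  rw [this]
  rfl

/-- Repeated differentiation in `x` of a differential function along `f`. -/
theorem xDeriv_comp_xJetOf (hU : IsOpen U) (hf : ContDiffOn ℝ ∞ f U) (hs : IsOpen s)
    (hh : ContDiffOn ℝ ∞ h s) (hUs : MapsTo (xJetOf n f) U s) (k : ℕ) :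
    EqOn (xDeriv k fun q => h (xJetOf n f q))
      (fun q => XJet.iterTotalDx h k (xJetOf (n + k) f q)) U := by
  induction k with
  | zero => intro p _; simp [xDeriv, XJet.iterTotalDx]
  | succ k ih =>
    intro p hp
    rw [xDeriv_succ_eq_fderiv hU (contDiffOn_comp_xJetOf hU hf hh hUs) k hp,
      fderiv_congr_of_eqOn hU ih hp]
    exact fderiv_comp_xJetOf_x (s := XJet.truncate n k ⁻¹' s) hU hf
      (XJet.isOpen_truncate_preimage hs k) (XJet.contDiffOn_iterTotalDx hs hh k)
      (fun q hq => hUs hq) hp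

end ParameterCalculus

/-! ### Variation of constants -/

/-- Let the columns of a Wronski matrix satisfy a linear equation with coefficients `c` and let
`g` be the coefficients of a function with derivatives `W` in terms of these columns. Then the
derivative `g'` of `g` vanishes if and only if the function satisfies the equation. -/
theorem variation_of_constants {ρ : ℕ} (hρ : 1 ≤ ρ) {f : ℕ → Fin ρ → ℝ} {W : ℕ → ℝ}
    {c : Fin (ρ + 1) → ℝ} {g g' : Fin ρ → ℝ} (hc : c (Fin.last ρ) ≠ 0)
    (h0 : ∀ a, ∑ k : Fin (ρ + 1), c k * f k a = 0)
    (h1 : ∀ b : Fin ρ, ∑ a, f b a * g a = W b)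
    (h2 : ∀ b : Fin ρ, ∑ a, (f (b + 1) a * g a + f b a * g' a) = W (b + 1))
    (hdet : (Matrix.of fun a b : Fin ρ => f a b).det ≠ 0) :
    g' = 0 ↔ ∑ k : Fin (ρ + 1), c k * W k = 0 := by
  obtain ⟨n, rfl⟩ : ∃ n, ρ = n + 1 := ⟨ρ - 1, by omega⟩
  have hS : ∀ b : Fin (n + 1), ∑ a, f b a * g' a = W (b + 1) - ∑ a, f (b + 1) a * g a := by
    intro b
    rw [← h2 b, Finset.sum_add_distrib]
    ring
  -- Differentiating relation `b` and subtracting relation `b + 1` leaves `Σ f_b g' = 0`. This is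
  -- possible for all rows but the last, which has no successor among the relations `h1`.
  have hlow : ∀ b : Fin n, ∑ a, f (b : ℕ) a * g' a = 0 := by
    intro b
    have e1 := hS b.castSucc
    have e2 := h1 b.succ
    simp only [Fin.val_castSucc, Fin.val_succ] at e1 e2
    rw [e1, e2, sub_self]
  have hgsum : ∑ k : Fin (n + 2), c k * ∑ a, f k a * g a = 0 := by
    simp only [Finset.mul_sum]
    rw [Finset.sum_comm]
    refine Finset.sum_eq_zero fun a _ => ?_
    simp only [← mul_assoc, ← Finset.sum_mul, h0, zero_mul]
  -- In the equation for `W` the part with coefficients `g` cancels by `hgsum`, and only the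
  -- derivative of the last relation leaves a contribution, multiplied by the leading coefficient.
  have hsum : ∑ k : Fin (n + 2), c k * W k = c (Fin.last (n + 1)) * ∑ a, f n a * g' a := by
    have e1 := hS (Fin.last n)
    simp only [Fin.val_last] at e1
    rw [Fin.sum_univ_castSucc] at hgsum ⊢
    have e2 : ∀ i : Fin (n + 1), c i.castSucc * W i.castSucc =
        c i.castSucc * ∑ a, f i.castSucc a * g a := fun i => by rw [Fin.val_castSucc, h1]
    rw [Finset.sum_congr rfl fun i _ => e2 i, e1]
    simp only [Fin.val_last] at hgsum ⊢
    linear_combination hgsum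
  rw [hsum]
  constructor
  · rintro rfl
    simp
  · intro h
    have hn := (mul_eq_zero.1 h).resolve_left hc
    refine Matrix.eq_zero_of_mulVec_eq_zero hdet (funext fun b => ?_)
    change ∑ a, f b a * g' a = 0
    refine Fin.lastCases ?_ (fun i => ?_) b
    · exact hn
    · exact hlow i

theorem differentiableAt_det {ρ : ℕ} {M : ℝ → Matrix (Fin ρ) (Fin ρ) ℝ} {x : ℝ}
    (hM : ∀ i j, DifferentiableAt ℝ (fun s => M s i j) x) :
    DifferentiableAt ℝ (fun s => (M s).det) x := by
  simp only [Matrix.det_apply]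
  exact DifferentiableAt.fun_sum fun σ _ =>
    (DifferentiableAt.fun_finsetProd fun i _ => hM _ _).const_smul _

theorem differentiableAt_inv_mulVec {ρ : ℕ} {M : ℝ → Matrix (Fin ρ) (Fin ρ) ℝ}
    {v : ℝ → Fin ρ → ℝ} {x : ℝ} (hM : ∀ i j, DifferentiableAt ℝ (fun s => M s i j) x)
    (hv : ∀ i, DifferentiableAt ℝ (fun s => v s i) x) (hdet : (M x).det ≠ 0) (a : Fin ρ) :
    DifferentiableAt ℝ (fun s => ((M s)⁻¹.mulVec (v s)) a) x := by
  simp only [Matrix.mulVec, dotProduct, Matrix.inv_def, Matrix.smul_apply, smul_eq_mul,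
    Ring.inverse_eq_inv']
  refine DifferentiableAt.fun_sum fun b _ => DifferentiableAt.mul (DifferentiableAt.mul
    ((differentiableAt_det hM).inv hdet) ?_) (hv b)
  simp only [Matrix.adjugate_apply]
  refine differentiableAt_det fun i j => ?_
  by_cases hi : i = b
  · subst hi
    simp
  · simp only [Matrix.updateRow_apply, if_neg hi]
    exact hM i j

/-! ### The criterion of reduction -/

namespace Ansatz

variable {r ρ : ℕ} (A : Ansatz ρ) (E : EvolutionEquation r) (Q : ReducedField ρ)

/-- The result of the substitution of the ansatz with constant parameters into `H - u_t`. -/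
def defect (q : ℝ × ℝ × (Fin ρ → ℝ)) : ℝ := A.substH E q - tDeriv A.F q

/-- The value on the defect of the linearization of `η` along the ansatz. -/
def linearizedDefect (p : ℝ × ℝ × (Fin ρ → ℝ)) : ℝ :=
  ∑ k : Fin (ρ + 1), fderiv ℝ Q.η (xJetOf ρ A.F p) (0, 0, Pi.single k 1) *
    xDeriv k (A.defect E) p

variable {A E Q} {p : ℝ × ℝ × (Fin ρ → ℝ)}

theorem contDiffOn_substH (hE : A.SubstitutableIn E) : ContDiffOn ℝ ∞ (A.substH E) A.domain :=
  contDiffOn_comp_xJetOf A.isOpen_domain A.smooth E.smooth hE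

theorem contDiffOn_defect (hE : A.SubstitutableIn E) : ContDiffOn ℝ ∞ (A.defect E) A.domain :=
  (contDiffOn_substH hE).sub (contDiffOn_tDeriv A.isOpen_domain A.smooth)

theorem xDeriv_defect (hE : A.SubstitutableIn E) (hp : p ∈ A.domain) (k : ℕ) :
    xDeriv k (A.defect E) p = XJet.iterTotalDx E.H k (xJetOf (r + k) A.F p) -
      fderiv ℝ (xDeriv k A.F) p (1, 0, 0) := by
  have h1 := xDeriv_sub A.isOpen_domain (contDiffOn_substH hE)
    (contDiffOn_tDeriv A.isOpen_domain A.smooth) k hp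
  have h2 := xDeriv_comp_xJetOf A.isOpen_domain A.smooth E.isOpen_domain E.smooth hE k hp
  rw [← xDeriv_tDeriv A.isOpen_domain A.smooth k hp]
  exact h1.trans (congrArg (· - _) h2)

/-- Chain rule for the identity `η = 0` along the ansatz. The `t`-direction is used to remove `η_t`
from the invariance condition; the `φ`-directions show that the columns of the Wronski matrix solve
the linearized equation. -/
theorem fderiv_charFun_eq_zero (hQ : A.ConstructedWith Q) (hp : p ∈ A.domain)
    (v : ℝ × ℝ × (Fin ρ → ℝ)) : fderiv ℝ Q.η (xJetOf ρ A.F p)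
      (v.1, v.2.1, fun k => fderiv ℝ (xDeriv k A.F) p v) = 0 := by
  rw [← fderiv_comp_xJetOf A.isOpen_domain A.smooth Q.isOpen_domain Q.smooth
    (fun q hq => (hQ q hq).1) hp v,
    fderiv_congr_of_eqOn (g := fun _ => 0) A.isOpen_domain (fun q hq => (hQ q hq).2) hp]
  simp

theorem linearizedDefect_eq (hQ : A.ConstructedWith Q) (hE : A.SubstitutableIn E)
    (hp : p ∈ A.domain) : A.linearizedDefect E Q p = fderiv ℝ Q.η (xJetOf ρ A.F p)
      (1, 0, fun k => XJet.iterTotalDx E.H k (xJetOf (r + k) A.F p)) := by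
  have h1 := XJet.fderiv_apply Q.η (xJetOf ρ A.F p) 0 0 fun k => xDeriv k (A.defect E) p
  have h2 := fderiv_charFun_eq_zero hQ hp (1, 0, 0)
  have h3 : ((0, 0, fun k => xDeriv k (A.defect E) p) : XJet ρ) =
      ((1, 0, fun k => XJet.iterTotalDx E.H k (xJetOf (r + k) A.F p)) : XJet ρ) -
      ((1, 0, fun k => fderiv ℝ (xDeriv k A.F) p (1, 0, 0)) : XJet ρ) := by
    ext k
    · simp
    · simp
    · exact xDeriv_defect hE hp k
  rw [h3, map_sub] at h1
  simp only [zero_mul, zero_add] at h1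
  rw [linearizedDefect]
  simp only [mul_comm (fderiv ℝ Q.η (xJetOf ρ A.F p) _)]
  rw [← h1, h2, sub_zero]

/-- A jet through which the ansatz passes is subject to the invariance condition if and only if
the linearization of `η` vanishes on the defect. -/
theorem invariantAt_iff_linearizedDefect (hr : 1 ≤ r) (hQ : A.ConstructedWith Q)
    (hE : A.SubstitutableIn E) (hp : p ∈ A.domain) {z : JetPoint} (hz : z ∈ jointManifold E Q)
    (hpz : xJetOf (r + ρ) A.F p = z.xJet (r + ρ)) :
    InvariantAt E Q z ↔ A.linearizedDefect E Q p = 0 := by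
  have ht : p.1 = z.t := congrArg (fun q => q.1) hpz
  have hx : p.2.1 = z.x := congrArg (fun q => q.2.1) hpz
  have hu : ∀ k (hk : k < r + ρ + 1), xDeriv k A.F p = z.u 0 k := fun k hk =>
    congrFun (congrArg (fun q => q.2.2) hpz) ⟨k, hk⟩
  have hJ : ∀ k ≤ r + ρ, xJetOf k A.F p = z.xJet k := fun k hk => by
    simp only [xJetOf, JetPoint.xJet, ht, hx]
    congr 2
    exact funext fun j => hu j (by omega)
  rw [invariantAt_iff hr E Q hz, linearizedDefect_eq hQ hE hp, hJ ρ (by omega)]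
  have : (fun k : Fin (ρ + 1) => XJet.iterTotalDx E.H k (xJetOf (r + k) A.F p)) =
      fun k : Fin (ρ + 1) => XJet.iterTotalDx E.H k (z.xJet (r + k)) :=
    funext fun k => by rw [hJ (r + k) (by omega)]
  rw [this]

theorem hasDerivAt_phiDeriv {t x : ℝ} {φ : Fin ρ → ℝ} (hp : (t, x, φ) ∈ A.domain) (k : ℕ)
    (a : Fin ρ) : HasDerivAt (fun s => phiDeriv a (xDeriv k A.F) (t, s, φ))
      (phiDeriv a (xDeriv (k + 1) A.F) (t, x, φ)) x := by
  have hU := A.isOpen_domain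
  have hk := contDiffOn_xDeriv hU A.smooth k
  have h1 := hasDerivAt_comp_xLine hU (contDiffOn_fderiv_apply hU hk (0, 0, Pi.single a 1)) hp
  rw [fderiv_fderiv_comm hU hk hp, fderiv_congr_of_eqOn hU
    (fun q hq => (xDeriv_succ_eq_fderiv hU A.smooth k hq).symm) hp,
    ← phiDeriv_eq_fderiv hU (contDiffOn_xDeriv hU A.smooth (k + 1)) hp] at h1
  refine h1.congr_of_eventuallyEq ?_
  have : ∀ᶠ s in 𝓝 x, (t, s, φ) ∈ A.domain :=
    (hasDerivAt_xLine t x φ).continuousAt.eventually_mem (hU.mem_nhds hp)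
  exact this.mono fun s hs => phiDeriv_eq_fderiv hU hk hs a

theorem hasDerivAt_xDeriv_defect (hE : A.SubstitutableIn E) {t x : ℝ} {φ : Fin ρ → ℝ}
    (hp : (t, x, φ) ∈ A.domain) (k : ℕ) :
    HasDerivAt (fun s => xDeriv k (A.defect E) (t, s, φ))
      (xDeriv (k + 1) (A.defect E) (t, x, φ)) x := by
  rw [xDeriv_succ_eq_fderiv A.isOpen_domain (contDiffOn_defect hE) k hp]
  exact hasDerivAt_comp_xLine A.isOpen_domain
    (contDiffOn_xDeriv A.isOpen_domain (contDiffOn_defect hE) k) hp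

theorem differentiableAt_G (hE : A.SubstitutableIn E) {t x : ℝ} {φ : Fin ρ → ℝ}
    (hp : (t, x, φ) ∈ A.domain) (a : Fin ρ) :
    DifferentiableAt ℝ (fun s => A.G E (t, s, φ) a) x :=
  differentiableAt_inv_mulVec (M := fun s => PhiMatrix A.F (t, s, φ))
    (fun i j => (hasDerivAt_phiDeriv hp i j).differentiableAt)
    (fun i => (hasDerivAt_xDeriv_defect hE hp i).differentiableAt) (A.det_ne_zero _ hp) a

theorem sum_phiDeriv_mul_G (hp : p ∈ A.domain) (b : Fin ρ) :
    ∑ a, phiDeriv a (xDeriv b A.F) p * A.G E p a = xDeriv b (A.defect E) p := by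
  have h : (PhiMatrix A.F p).mulVec (A.G E p) = fun b : Fin ρ => xDeriv b (A.defect E) p := by
    rw [G, Matrix.mulVec_mulVec, Matrix.mul_nonsing_inv _ (A.det_ne_zero p hp).isUnit,
      Matrix.one_mulVec]
    rfl
  exact congrFun h b

/-- Variation of constants with the fundamental system `F_{φ^a}` and the defect as the function
represented. Maximal rank of `η` supplies the nonzero leading coefficient. -/
theorem deriv_G_eq_zero_iff (hρ : 1 ≤ ρ) (hQ : A.ConstructedWith Q) (hE : A.SubstitutableIn E)
    {t x : ℝ} {φ : Fin ρ → ℝ} (hp : (t, x, φ) ∈ A.domain) :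
    (∀ a, deriv (fun s => A.G E (t, s, φ) a) x = 0) ↔ A.linearizedDefect E Q (t, x, φ) = 0 := by
  have hη : DifferentiableAt ℝ Q.η (xJetOf ρ A.F (t, x, φ)) :=
    (Q.smooth.contDiffAt (Q.isOpen_domain.mem_nhds (hQ _ hp).1)).differentiableAt (by simp)
  have key := variation_of_constants hρ (f := fun k a => phiDeriv a (xDeriv k A.F) (t, x, φ))
    (W := fun k => xDeriv k (A.defect E) (t, x, φ))
    (c := fun k => fderiv ℝ Q.η (xJetOf ρ A.F (t, x, φ)) (0, 0, Pi.single k 1))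
    (g := A.G E (t, x, φ)) (g' := fun a => deriv (fun s => A.G E (t, s, φ) a) x) ?_ ?_ ?_ ?_ ?_
  · rw [linearizedDefect, ← key]
    exact ⟨fun h => funext h, fun h a => congrFun h a⟩
  · rw [← XJet.partialU_eq_fderiv hη]
    exact Q.maxRank _ (hQ _ hp).1 (hQ _ hp).2
  · intro a
    have h1 := fderiv_charFun_eq_zero hQ hp (0, 0, Pi.single a 1)
    rw [XJet.fderiv_apply] at h1
    simp only [zero_mul, zero_add] at h1
    refine Eq.trans (Finset.sum_congr rfl fun k _ => ?_) h1
    rw [phiDeriv_eq_fderiv A.isOpen_domain (contDiffOn_xDeriv A.isOpen_domain A.smooth k) hp,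
      mul_comm]
  · exact fun b => sum_phiDeriv_mul_G hp b
  · intro b
    have h1 : HasDerivAt (fun s => ∑ a, phiDeriv a (xDeriv b A.F) (t, s, φ) * A.G E (t, s, φ) a)
        _ x := HasDerivAt.fun_sum fun a _ =>
      (hasDerivAt_phiDeriv hp b a).mul (differentiableAt_G hE hp a).hasDerivAt
    have h2 := hasDerivAt_xDeriv_defect hE hp b
    have h3 : ∀ᶠ s in 𝓝 x, (t, s, φ) ∈ A.domain :=
      (hasDerivAt_xLine t x φ).continuousAt.eventually_mem (A.isOpen_domain.mem_nhds hp)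
    exact h1.unique (h2.congr_of_eventuallyEq (h3.mono fun s hs => sum_phiDeriv_mul_G hs b))
  · exact A.det_ne_zero _ hp

/-- The ansatz reduces the equation if and only if the linearization of `η` vanishes on the
defect. -/
theorem reduces_iff_linearizedDefect (hρ : 1 ≤ ρ) (hQ : A.ConstructedWith Q)
    (hE : A.SubstitutableIn E) :
    A.Reduces E ↔ ∀ p ∈ A.domain, A.linearizedDefect E Q p = 0 := by
  have hsec : ∀ (t : ℝ) (φ : Fin ρ → ℝ), IsOpen {x : ℝ | (t, x, φ) ∈ A.domain} := fun t φ =>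
    A.isOpen_domain.preimage (by fun_prop)
  constructor
  · rintro ⟨-, g, hg⟩ ⟨t, x, φ⟩ hp
    rw [← deriv_G_eq_zero_iff hρ hQ hE hp]
    intro a
    have : (fun s => A.G E (t, s, φ) a) =ᶠ[𝓝 x] fun _ => g t φ a := by
      filter_upwards [(hsec t φ).mem_nhds hp] with s hs
      rw [hg t s φ hs]
    rw [this.deriv_eq, deriv_const]
  · intro h
    have hconst : ∀ (t : ℝ) (φ : Fin ρ → ℝ) (x y : ℝ), (t, x, φ) ∈ A.domain →
        (t, y, φ) ∈ A.domain → A.G E (t, x, φ) = A.G E (t, y, φ) := by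
      intro t φ x y hx hy
      funext a
      -- Here the sections of the domain must be intervals: on a disconnected section a zero
      -- derivative would not exclude different constants.
      exact (hsec t φ).is_const_of_deriv_eq_zero (f := fun s => A.G E (t, s, φ) a)
        (A.ordConnected t φ).isPreconnected
        (fun s hs => (differentiableAt_G hE hs a).differentiableWithinAt)
        (fun s hs => (deriv_G_eq_zero_iff hρ hQ hE hs).2 (h _ hs) a) hx hy
    classical
    refine ⟨hE, fun t φ => if hx : ∃ x, (t, x, φ) ∈ A.domain then
      A.G E (t, hx.choose, φ) else 0, fun t x φ hp => ?_⟩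
    have hx : ∃ x, (t, x, φ) ∈ A.domain := ⟨x, hp⟩
    simp only [dif_pos hx]
    exact hconst t φ _ _ hp hx.choose_spec

theorem iterTotalDx_charFun_eq_zero (hQ : A.ConstructedWith Q) (hp : p ∈ A.domain) (k : ℕ) :
    XJet.iterTotalDx Q.η k (xJetOf (ρ + k) A.F p) = 0 := by
  rw [← xDeriv_zero_fun k p]
  refine (xDeriv_comp_xJetOf A.isOpen_domain A.smooth Q.isOpen_domain Q.smooth
    (fun q hq => (hQ q hq).1) k hp).symm.trans ?_
  exact xDeriv_congr A.isOpen_domain (fun q hq => (hQ q hq).2) k hp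

/-- Only the pure `x`-derivatives of the jet are taken from `F`; those involving `t` are dictated by
the equation, which the ansatz with constant parameters need not satisfy. -/
theorem exists_mem_jointManifold (hQ : A.ConstructedWith Q) (hE : A.SubstitutableIn E)
    (hp : p ∈ A.domain) :
    ∃ z ∈ jointManifold E Q, xJetOf (r + ρ) A.F p = z.xJet (r + ρ) := by
  obtain ⟨z, hz, ht, hx, hu⟩ := E.exists_mem_manifold ρ p.1 p.2.1 (fun k => xDeriv k A.F p)
    (hE p hp)
  have hJ : ∀ k, z.xJet k = xJetOf k A.F p := fun k => by
    simp only [xJetOf, JetPoint.xJet, ht, hx, hu]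
  have hzQ : z.xJet ρ ∈ Q.domain := by
    rw [hJ]
    exact (hQ p hp).1
  refine ⟨z, ⟨hz, hzQ, fun k _ => ?_⟩, (hJ _).symm⟩
  rw [Q.iterate_totalDx_charFun hzQ, hJ]
  exact iterTotalDx_charFun_eq_zero hQ hp k

/-- An ansatz that is constructed with `Q` and can be substituted into `E` reduces `E` if and only
if the invariance condition holds at all points of the joint manifold through which it passes. -/
theorem reduces_iff (hr : 1 ≤ r) (hρ : 1 ≤ ρ) (hQ : A.ConstructedWith Q)
    (hE : A.SubstitutableIn E) : A.Reduces E ↔ ∀ z ∈ jointManifold E Q,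
      A.PassesThrough (r + ρ) z → InvariantAt E Q z := by
  rw [reduces_iff_linearizedDefect hρ hQ hE]
  constructor
  · rintro h z hz ⟨p, hp, hpz⟩
    exact (invariantAt_iff_linearizedDefect hr hQ hE hp hz hpz).2 (h p hp)
  · intro h p hp
    obtain ⟨z, hz, hpz⟩ := exists_mem_jointManifold hQ hE hp
    exact (invariantAt_iff_linearizedDefect hr hQ hE hp hz hpz).1 (h z hz ⟨p, hp, hpz⟩)

end Ansatz

/-! ### Existence of ansatzes -/

namespace XJet

variable {n : ℕ}

/-- `D_x f` is affine in the top coordinate `u_{n+1}`, which occurs only as the factor of `∂f/∂u_n`.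
-/
theorem totalDx_sub_totalDx (f : XJet n → ℝ) {p q : XJet (n + 1)}
    (h : truncate n 1 p = truncate n 1 q) : totalDx f p - totalDx f q =
      (p.2.2 (Fin.last (n + 1)) - q.2.2 (Fin.last (n + 1))) *
        fderiv ℝ f (truncate n 1 q) (0, 0, Pi.single (Fin.last n) 1) := by
  have hc : ∀ j : Fin (n + 1), p.2.2 j.castSucc = q.2.2 j.castSucc := fun j =>
    congrFun (congrArg (fun m : XJet n => m.2.2) h) j
  have hd : ((0, 1, fun k => p.2.2 k.succ) : XJet n) - (0, 1, fun k => q.2.2 k.succ) =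
      (p.2.2 (Fin.last (n + 1)) - q.2.2 (Fin.last (n + 1))) •
        ((0, 0, Pi.single (Fin.last n) 1) : XJet n) := by
    ext j
    · simp
    · simp
    · refine Fin.lastCases ?_ (fun i => ?_) j
      · simp
      · have := hc i.succ
        simp only [← Fin.succ_castSucc] at this
        simp [this]
  rw [totalDx, totalDx, h, ← map_sub, hd, map_smul, smul_eq_mul]

theorem partialU_last_totalDx (f : XJet n → ℝ) (p : XJet (n + 1)) :
    partialU (Fin.last (n + 1)) (totalDx f) p =
      fderiv ℝ f (truncate n 1 p) (0, 0, Pi.single (Fin.last n) 1) := by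
  have h : (fun s => totalDx f (p.1, p.2.1, Function.update p.2.2 (Fin.last (n + 1)) s)) =
      fun s => (s - p.2.2 (Fin.last (n + 1))) *
        fderiv ℝ f (truncate n 1 p) (0, 0, Pi.single (Fin.last n) 1) + totalDx f p := by
    ext s
    rw [← sub_eq_iff_eq_add, totalDx_sub_totalDx]
    · simp only [Function.update_self]
    · simp only [truncate]
      congr 2
      ext j
      rw [Function.update_of_ne]
      intro hj
      have := congrArg Fin.val hj
      simp at this
      omega
  rw [partialU, h]
  have := ((((hasDerivAt_id (p.2.2 (Fin.last (n + 1)))).sub_const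
    (p.2.2 (Fin.last (n + 1)))).mul_const
    (fderiv ℝ f (truncate n 1 p) (0, 0, Pi.single (Fin.last n) 1))).add_const (totalDx f p)).deriv
  rwa [one_mul] at this

/-- Each `D_x` passes the coefficient of the top derivative on unchanged. For `η` this coefficient
is always `η_{u_ρ}`, so every consequence `D_x^k η = 0` determines `u_{ρ+k}`. -/
theorem fderiv_iterTotalDx_last {f : XJet n → ℝ} {s : Set (XJet n)} (hs : IsOpen s)
    (hf : ContDiffOn ℝ ∞ f s) (k : ℕ) : ∀ p ∈ truncate n k ⁻¹' s,
      fderiv ℝ (iterTotalDx f k) p (0, 0, Pi.single (Fin.last (n + k)) 1) =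
        fderiv ℝ f (truncate n k p) (0, 0, Pi.single (Fin.last n) 1) := by
  induction k with
  | zero => intro p _; rfl
  | succ k ih =>
    intro p hp
    have hd : DifferentiableAt ℝ (iterTotalDx f (k + 1)) p :=
      ((contDiffOn_iterTotalDx hs hf (k + 1)).contDiffAt
        ((isOpen_truncate_preimage hs (k + 1)).mem_nhds hp)).differentiableAt (by simp)
    refine (partialU_eq_fderiv hd (Fin.last (n + k + 1))).symm.trans ?_
    refine (partialU_last_totalDx (iterTotalDx f k) p).trans ?_
    exact ih (truncate (n + k) 1 p) hp

/-- The jet with variables `(t, x, u_0, …, u_{n-1})` and top derivative `u_n = a`. -/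
def extendBy (q : (ℝ × ℝ × (Fin n → ℝ)) × ℝ) : XJet n :=
  (q.1.1, q.1.2.1, Fin.snoc (α := fun _ => ℝ) q.1.2.2 q.2)

theorem contDiff_extendBy : ContDiff ℝ ∞ (extendBy (n := n)) := by
  unfold extendBy
  refine ContDiff.prodMk (by fun_prop) (ContDiff.prodMk (by fun_prop) (contDiff_pi.2 fun j => ?_))
  refine Fin.lastCases ?_ (fun i => ?_) j
  · simp only [Fin.snoc_last]
    fun_prop
  · simp only [Fin.snoc_castSucc]
    fun_prop

theorem extendBy_init (p : XJet n) :
    extendBy ((p.1, p.2.1, fun j => p.2.2 j.castSucc), p.2.2 (Fin.last n)) = p := by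
  refine Prod.ext rfl (Prod.ext rfl (funext fun j => ?_))
  refine Fin.lastCases ?_ (fun i => ?_) j <;> simp [extendBy]

end XJet

theorem isInvertible_of_apply_one_ne_zero {L : ℝ →L[ℝ] ℝ} (h : L 1 ≠ 0) : L.IsInvertible := by
  refine ⟨ContinuousLinearEquiv.unitsEquivAut ℝ (Units.mk0 (L 1) h), ?_⟩
  ext
  simp

/-! ### Normal form and local general solution of `η = 0` -/

namespace ReducedField

variable {ρ : ℕ} (Q : ReducedField ρ)

theorem contDiffAt_extendBy {q : (ℝ × ℝ × (Fin ρ → ℝ)) × ℝ} (hq : XJet.extendBy q ∈ Q.domain) :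
    ContDiffAt ℝ ∞ (fun q => Q.η (XJet.extendBy q)) q :=
  (Q.smooth.contDiffAt (Q.isOpen_domain.mem_nhds hq)).comp q XJet.contDiff_extendBy.contDiffAt

theorem isInvertible_fderiv_extendBy {q : (ℝ × ℝ × (Fin ρ → ℝ)) × ℝ}
    (hq : XJet.extendBy q ∈ Q.domain) (h0 : Q.η (XJet.extendBy q) = 0) :
    (fderiv ℝ (fun q => Q.η (XJet.extendBy q)) q ∘L
      .inr ℝ (ℝ × ℝ × (Fin ρ → ℝ)) ℝ).IsInvertible := by
  refine isInvertible_of_apply_one_ne_zero ?_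
  have h1 : HasDerivAt (fun s : ℝ => Q.η (XJet.extendBy (q.1, s)))
      (fderiv ℝ (fun q => Q.η (XJet.extendBy q)) q (0, 1)) q.2 :=
    (((Q.contDiffAt_extendBy hq).differentiableAt (by simp)).hasFDerivAt).comp_hasDerivAt_of_eq q.2
      ((hasDerivAt_const _ _).prodMk (hasDerivAt_id _)) rfl
  have h2 := Q.maxRank _ hq h0
  have h3 : (fun s => Q.η ((XJet.extendBy q).1, (XJet.extendBy q).2.1,
      Function.update (XJet.extendBy q).2.2 (Fin.last ρ) s)) =
      fun s : ℝ => Q.η (XJet.extendBy (q.1, s)) := by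
    ext s
    simp only [XJet.extendBy, Fin.update_snoc_last]
  have h4 : (XJet.extendBy q).2.2 (Fin.last ρ) = q.2 := by simp [XJet.extendBy]
  rw [XJet.partialU, h3, h4, h1.deriv] at h2
  exact h2

/-- The equation `η = 0` can be solved locally for the derivative of highest order. -/
theorem exists_normal_form {p₀ : XJet ρ} (hp₀ : p₀ ∈ Q.domain) (h0 : Q.η p₀ = 0) :
    ∃ R : ℝ × ℝ × (Fin ρ → ℝ) → ℝ, ∃ s : Set (ℝ × ℝ × (Fin ρ → ℝ)), IsOpen s ∧
      (p₀.1, p₀.2.1, fun j => p₀.2.2 j.castSucc) ∈ s ∧ ContDiffOn ℝ ∞ R s ∧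
      R (p₀.1, p₀.2.1, fun j => p₀.2.2 j.castSucc) = p₀.2.2 (Fin.last ρ) ∧
      ∀ q ∈ s, XJet.extendBy (q, R q) ∈ Q.domain ∧ Q.η (XJet.extendBy (q, R q)) = 0 := by
  set q₀ : (ℝ × ℝ × (Fin ρ → ℝ)) × ℝ :=
    ((p₀.1, p₀.2.1, fun j => p₀.2.2 j.castSucc), p₀.2.2 (Fin.last ρ)) with hq₀
  have he : XJet.extendBy q₀ = p₀ := XJet.extendBy_init p₀
  rw [← he] at hp₀ h0
  have hc := Q.contDiffAt_extendBy hp₀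
  have hi := Q.isInvertible_fderiv_extendBy hp₀ h0
  set R := hc.implicitFunction (by simp) hi with hR
  have hR0 : R q₀.1 = q₀.2 := hc.implicitFunction_apply_self (by simp) hi
  -- `ContDiffAt ℝ ∞` at one point does not by itself give a neighbourhood of `C^∞` points, whereas
  -- `C^1` regularity does spread. Continuity nearby then suffices to apply the implicit function
  -- theorem anew at each point of `s`.
  have hRc : ContDiffAt ℝ 1 R q₀.1 :=
    (hc.contDiffAt_implicitFunction (by simp) hi).of_le (by norm_num)
  have hev1 : ∀ᶠ q in 𝓝 q₀.1, Q.η (XJet.extendBy (q, R q)) = 0 := by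
    have := hc.eventually_apply_implicitFunction (by simp) hi
    rw [h0] at this
    exact this
  have hev2 : ∀ᶠ q in 𝓝 q₀.1, ContDiffAt ℝ 1 R q := hRc.eventually (by simp)
  have hev3 : ∀ᶠ q in 𝓝 q₀.1, XJet.extendBy (q, R q) ∈ Q.domain := by
    have : ContinuousAt (fun q => XJet.extendBy (q, R q)) q₀.1 :=
      XJet.contDiff_extendBy.continuous.continuousAt.comp
        (continuousAt_id.prodMk hRc.continuousAt)
    refine this.eventually_mem (Q.isOpen_domain.mem_nhds ?_)
    rw [hR0]
    exact hp₀
  obtain ⟨s, hs, hso, hsm⟩ := mem_nhds_iff.1 (hev1.and (hev2.and hev3))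
  refine ⟨R, s, hso, hsm, fun q hq => ?_, hR0, fun q hq => ⟨(hs hq).2.2, (hs hq).1⟩⟩
  refine (SmoothFlow.contDiffAt_of_implicit (Q.contDiffAt_extendBy (hs hq).2.2) (by simp)
    (Q.isInvertible_fderiv_extendBy (hs hq).2.2 (hs hq).1) (hs hq).2.1.continuousAt
    ?_).contDiffWithinAt
  filter_upwards [hso.mem_nhds hq] with q' hq'
  rw [(hs hq').1, (hs hq).1]

/-- Local solutions of `η = 0` that depend smoothly on their initial values. -/
theorem exists_general_solution {p₀ : XJet ρ} (hp₀ : p₀ ∈ Q.domain)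
    (h0 : Q.η p₀ = 0) : ∃ F : ℝ × ℝ × (Fin ρ → ℝ) → ℝ, ∃ U : Set (ℝ × ℝ × (Fin ρ → ℝ)),
      IsOpen U ∧ (p₀.1, p₀.2.1, fun j => p₀.2.2 j.castSucc) ∈ U ∧ ContDiffOn ℝ ∞ F U ∧
      (∀ q ∈ U, xJetOf ρ F q ∈ Q.domain ∧ Q.η (xJetOf ρ F q) = 0) ∧
      xJetOf ρ F (p₀.1, p₀.2.1, fun j => p₀.2.2 j.castSucc) = p₀ ∧
      PhiMatrix F (p₀.1, p₀.2.1, fun j => p₀.2.2 j.castSucc) = 1 := by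
  obtain ⟨R, s, hs, hsm, hR, hR0, hsol⟩ := Q.exists_normal_form hp₀ h0
  set q₀ : ℝ × ℝ × (Fin ρ → ℝ) := (p₀.1, p₀.2.1, fun j => p₀.2.2 j.castSucc) with hq₀
  let jet : ℝ × ℝ × (Fin ρ → ℝ) → XJet ρ := fun q => XJet.extendBy (q, R q)
  have hjet : ContDiffOn ℝ ∞ jet s :=
    XJet.contDiff_extendBy.comp_contDiffOn (contDiffOn_id.prodMk hR)
  have hjetk : ∀ k, ContDiffOn ℝ ∞ (fun q => (jet q).2.2 k) s := fun k =>
    contDiffOn_pi.1 hjet.snd.snd k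
  -- The equation as an autonomous system: `t' = 0`, `x' = 1`, `u_a' = u_{a+1}`, and `u_{ρ-1}' = R`.
  have hV : ContDiffOn ℝ ∞ (fun q => ((0, 1, fun a => (jet q).2.2 a.succ) :
      ℝ × ℝ × (Fin ρ → ℝ))) s :=
    contDiffOn_const.prodMk (contDiffOn_const.prodMk (contDiffOn_pi.2 fun a => hjetk a.succ))
  obtain ⟨ε, hε, Y, hY, hY0, hYV⟩ := SmoothFlow.exists_contDiffOn_flow (hs.mem_nhds hsm) hV
  -- The parameters `φ` are the values of `u_0, …, u_{ρ-1}` at the fixed abscissa `p₀.2.1`; the flow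
  -- carries them from there to `x`.
  let Z : ℝ × ℝ × (Fin ρ → ℝ) → ℝ × ℝ × (Fin ρ → ℝ) := fun q =>
    Y (q.2.1 - p₀.2.1, (q.1, p₀.2.1, q.2.2))
  let U : Set (ℝ × ℝ × (Fin ρ → ℝ)) := {q | q.2.1 - p₀.2.1 ∈ Metric.ball (0 : ℝ) ε ∧
    (q.1, p₀.2.1, q.2.2) ∈ Metric.ball q₀ ε}
  have hUo : IsOpen U :=
    (Metric.isOpen_ball.preimage (by fun_prop :
      Continuous fun q : ℝ × ℝ × (Fin ρ → ℝ) => q.2.1 - p₀.2.1)).inter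
    (Metric.isOpen_ball.preimage (by fun_prop :
      Continuous fun q : ℝ × ℝ × (Fin ρ → ℝ) => (q.1, p₀.2.1, q.2.2)))
  have hq₀U : q₀ ∈ U := ⟨by simpa [hq₀] using hε, Metric.mem_ball_self hε⟩
  have hZ : ContDiffOn ℝ ∞ Z U := hY.comp (ContDiff.contDiffOn (by fun_prop)) fun q hq => hq
  have hZs : MapsTo Z U s := fun q hq => (hYV _ hq.1 _ hq.2).1
  have hZd : ∀ (t x : ℝ) (φ : Fin ρ → ℝ), (t, x, φ) ∈ U → HasDerivAt (fun x => Z (t, x, φ))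
      (0, 1, fun a => (jet (Z (t, x, φ))).2.2 a.succ) x := fun t x φ h => by
    have h1 := (hYV _ h.1 _ h.2).2
    have h2 := HasDerivAt.scomp x h1 ((hasDerivAt_id x).sub_const p₀.2.1)
    rw [one_smul] at h2
    exact h2
  have hZ1 : ∀ q ∈ U, (Z q).1 = q.1 ∧ (Z q).2.1 = q.2.1 := by
    intro q hq
    have hd : ∀ τ ∈ Metric.ball (0 : ℝ) ε,
        HasDerivAt (fun τ => Y (τ, (q.1, p₀.2.1, q.2.2))) _ τ := fun τ hτ =>
      (hYV τ hτ _ hq.2).2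
    have hd1 : ∀ τ ∈ Metric.ball (0 : ℝ) ε,
        HasDerivAt (fun τ => (Y (τ, (q.1, p₀.2.1, q.2.2))).1) 0 τ := fun τ hτ => by
      simpa using (hd τ hτ).hasFDerivAt.fst.hasDerivAt
    have hd2 : ∀ τ ∈ Metric.ball (0 : ℝ) ε,
        HasDerivAt (fun τ => (Y (τ, (q.1, p₀.2.1, q.2.2))).2.1 - τ) 0 τ := fun τ hτ => by
      have h : HasDerivAt (fun τ => (Y (τ, (q.1, p₀.2.1, q.2.2))).2.1) 1 τ := by
        simpa using (hd τ hτ).hasFDerivAt.snd.fst.hasDerivAt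
      simpa using h.fun_sub (hasDerivAt_id' τ)
    have hpre : IsPreconnected (Metric.ball (0 : ℝ) ε) := (convex_ball _ _).isPreconnected
    have h1 := Metric.isOpen_ball.is_const_of_deriv_eq_zero
      (f := fun τ => (Y (τ, (q.1, p₀.2.1, q.2.2))).1) hpre
      (fun τ hτ => (hd1 τ hτ).differentiableAt.differentiableWithinAt)
      (fun τ hτ => (hd1 τ hτ).deriv) hq.1 (Metric.mem_ball_self hε)
    have h2 := Metric.isOpen_ball.is_const_of_deriv_eq_zero
      (f := fun τ => (Y (τ, (q.1, p₀.2.1, q.2.2))).2.1 - τ) hpre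
      (fun τ hτ => (hd2 τ hτ).differentiableAt.differentiableWithinAt)
      (fun τ hτ => (hd2 τ hτ).deriv) hq.1 (Metric.mem_ball_self hε)
    simp only [hY0] at h1 h2
    exact ⟨h1, by change (Y _).2.1 = _; linarith⟩
  let F : ℝ × ℝ × (Fin ρ → ℝ) → ℝ := fun q => (jet (Z q)).2.2 0
  have hF : ContDiffOn ℝ ∞ F U := (hjetk 0).comp hZ hZs
  have hFk : ∀ k (hk : k < ρ + 1), ∀ q ∈ U, xDeriv k F q = (jet (Z q)).2.2 ⟨k, hk⟩ := by
    intro k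
    induction k with
    | zero => intro _ q _; simp [xDeriv, F]
    | succ k ih =>
      rintro hk ⟨t, x, φ⟩ hq
      rw [xDeriv_succ]
      have hev : (fun y => xDeriv k F (t, y, φ)) =ᶠ[𝓝 x]
          fun y => (Z (t, y, φ)).2.2 ⟨k, by omega⟩ := by
        have : ∀ᶠ y in 𝓝 x, (t, y, φ) ∈ U :=
          (hasDerivAt_xLine t x φ).continuousAt.eventually_mem (hUo.mem_nhds hq)
        filter_upwards [this] with y hy
        rw [ih (by omega) _ hy]
        exact Fin.snoc_castSucc (α := fun _ => ℝ) _ _ (⟨k, by omega⟩ : Fin ρ)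
      simp only
      rw [hev.deriv_eq]
      exact (hasDerivAt_pi.1 (hZd t x φ hq).snd.snd ⟨k, by omega⟩).deriv
  have hFJ : ∀ q ∈ U, xJetOf ρ F q = jet (Z q) := fun q hq =>
    Prod.ext (hZ1 q hq).1.symm (Prod.ext (hZ1 q hq).2.symm
      (funext fun k => hFk k k.2 q hq))
  -- At the initial abscissa the flow is the identity, so there `F_0, …, F_{ρ-1}` are the parameters
  -- themselves and `Φ = 1`.
  have hZ0 : ∀ φ, Z (p₀.1, p₀.2.1, φ) = (p₀.1, p₀.2.1, φ) := fun φ => by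
    simp only [Z, sub_self, hY0]
  refine ⟨F, U, hUo, hq₀U, hF, fun q hq => ?_, ?_, ?_⟩
  · rw [hFJ q hq]
    exact hsol _ (hZs hq)
  · rw [hFJ _ hq₀U, hZ0]
    change XJet.extendBy (q₀, R q₀) = p₀
    rw [hR0]
    exact XJet.extendBy_init p₀
  · ext a b
    rw [PhiMatrix, Matrix.of_apply, phiDeriv]
    have hev : (fun c => xDeriv a F (p₀.1, p₀.2.1, Function.update q₀.2.2 b c)) =ᶠ[𝓝 (q₀.2.2 b)]
        fun c => Function.update q₀.2.2 b c a := by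
      have : ∀ᶠ c in 𝓝 (q₀.2.2 b), (p₀.1, p₀.2.1, Function.update q₀.2.2 b c) ∈ U :=
        (hasDerivAt_phiLine p₀.1 p₀.2.1 q₀.2.2 b).continuousAt.eventually_mem
          (hUo.mem_nhds (by simpa [hq₀] using hq₀U))
      filter_upwards [this] with c hc
      rw [hFk a (by omega) _ hc, hZ0]
      exact Fin.snoc_castSucc (α := fun _ => ℝ) _ _ a
    refine hev.deriv_eq.trans ?_
    rw [(hasDerivAt_pi.1 (hasDerivAt_update q₀.2.2 b (q₀.2.2 b)) a).deriv, Matrix.one_apply,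
      Pi.single_apply]

end ReducedField

/-! ### Ansatzes through the points of the joint manifold -/

variable {r ρ : ℕ}

/-- A solution of `η = 0` is determined up to any order by its derivatives of order at most
`ρ`. -/
theorem xJetOf_eq_of_mem_manifold {Q : ReducedField ρ} {F : ℝ × ℝ × (Fin ρ → ℝ) → ℝ}
    {U : Set (ℝ × ℝ × (Fin ρ → ℝ))} (hU : IsOpen U) (hF : ContDiffOn ℝ ∞ F U)
    (hη : ∀ q ∈ U, xJetOf ρ F q ∈ Q.domain ∧ Q.η (xJetOf ρ F q) = 0)
    {p : ℝ × ℝ × (Fin ρ → ℝ)} (hp : p ∈ U) {z : JetPoint} (hz : z ∈ Q.manifold r)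
    (h : xJetOf ρ F p = z.xJet ρ) {k : ℕ} (hk : k ≤ r) :
    xJetOf (ρ + k) F p = z.xJet (ρ + k) := by
  induction k with
  | zero => exact h
  | succ k ih =>
    have ih' := ih (by omega)
    have h1 : XJet.iterTotalDx Q.η (k + 1) (xJetOf (ρ + (k + 1)) F p) = 0 := by
      rw [← xDeriv_zero_fun (k + 1) p]
      exact (xDeriv_comp_xJetOf hU hF Q.isOpen_domain Q.smooth
        (fun q hq => (hη q hq).1) (k + 1) hp).symm.trans
        (xDeriv_congr hU (fun q hq => (hη q hq).2) (k + 1) hp)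
    have h2 : XJet.iterTotalDx Q.η (k + 1) (z.xJet (ρ + (k + 1))) = 0 := by
      rw [← Q.iterate_totalDx_charFun hz.1]
      exact hz.2 (k + 1) hk
    -- The two jets agree up to order `ρ + k` and `D_x^{k+1} η` vanishes at both; being affine in
    -- the next coordinate with slope `η_{u_ρ} ≠ 0`, it forces that coordinate to agree.
    have h3 := XJet.totalDx_sub_totalDx (XJet.iterTotalDx Q.η k)
      (p := xJetOf (ρ + k + 1) F p) (q := z.xJet (ρ + k + 1)) ih'
    have h4 : fderiv ℝ (XJet.iterTotalDx Q.η k) (z.xJet (ρ + k))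
        (0, 0, Pi.single (Fin.last (ρ + k)) 1) =
          fderiv ℝ Q.η (z.xJet ρ) (0, 0, Pi.single (Fin.last ρ) 1) :=
      XJet.fderiv_iterTotalDx_last Q.isOpen_domain Q.smooth k (z.xJet (ρ + k)) hz.1
    have hd : DifferentiableAt ℝ Q.η (z.xJet ρ) :=
      (Q.smooth.contDiffAt (Q.isOpen_domain.mem_nhds hz.1)).differentiableAt (by simp)
    have h5 : fderiv ℝ Q.η (z.xJet ρ) (0, 0, Pi.single (Fin.last ρ) 1) ≠ 0 := by
      rw [← XJet.partialU_eq_fderiv hd]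
      exact Q.maxRank _ hz.1 (hz.2 0 (Nat.zero_le r))
    have h6 : xDeriv (ρ + k + 1) F p = z.u 0 (ρ + k + 1) := by
      have h7 : (xDeriv (ρ + k + 1) F p - z.u 0 (ρ + k + 1)) *
          fderiv ℝ Q.η (z.xJet ρ) (0, 0, Pi.single (Fin.last ρ) 1) = 0 := by
        rw [← h4]
        refine h3.symm.trans ?_
        rw [sub_eq_zero]
        exact h1.trans h2.symm
      exact sub_eq_zero.1 ((mul_eq_zero.1 h7).resolve_right h5)
    refine Prod.ext (congrArg (fun q => q.1) h) (Prod.ext (congrArg (fun q => q.2.1) h)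
      (funext fun j => ?_))
    refine Fin.lastCases (n := ρ + k + 1) ?_ (fun i => ?_) j
    · exact h6
    · exact congrFun (congrArg (fun q => q.2.2) ih') i

/-- Through every point of the joint manifold there passes an ansatz that is constructed with `Q`
and can be substituted into `E`. -/
theorem exists_ansatz {E : EvolutionEquation r} {Q : ReducedField ρ} {z : JetPoint}
    (hz : z ∈ jointManifold E Q) : ∃ A : Ansatz ρ,
      A.ConstructedWith Q ∧ A.SubstitutableIn E ∧ A.PassesThrough (r + ρ) z := by
  obtain ⟨F, U, hU, hpU, hF, hη, hJ, hΦ⟩ :=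
    Q.exists_general_solution hz.2.1 (hz.2.2 0 (Nat.zero_le r))
  set p : ℝ × ℝ × (Fin ρ → ℝ) :=
    ((z.xJet ρ).1, (z.xJet ρ).2.1, fun j => (z.xJet ρ).2.2 j.castSucc) with hp
  have hjet : xJetOf (ρ + r) F p = z.xJet (ρ + r) :=
    xJetOf_eq_of_mem_manifold hU hF hη hpU hz.2 hJ le_rfl
  have hjet' : ∀ k ≤ ρ + r, xJetOf k F p = z.xJet k := fun k hk =>
    Prod.ext rfl (Prod.ext rfl (funext fun j =>
      congrFun (congrArg (fun q => q.2.2) hjet) ⟨j, by omega⟩))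
  have hdet : ∀ᶠ q in 𝓝 p, (PhiMatrix F q).det ≠ 0 := by
    have hc : ContinuousAt (PhiMatrix F) p := by
      refine continuousAt_pi.2 fun a => continuousAt_pi.2 fun b => ?_
      have h1 := contDiffOn_xDeriv hU hF (a : ℕ)
      have h2 := ((contDiffOn_fderiv_apply hU h1 (0, 0, Pi.single b 1)).continuousOn).continuousAt
        (hU.mem_nhds hpU)
      refine h2.congr ?_
      filter_upwards [hU.mem_nhds hpU] with q hq
      exact (phiDeriv_eq_fderiv hU h1 hq b).symm
    have hc' : ContinuousAt (fun q => (PhiMatrix F q).det) p :=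
      (Continuous.matrix_det continuous_id).continuousAt.comp hc
    refine hc'.eventually_ne ?_
    rw [hΦ, Matrix.det_one]
    exact one_ne_zero
  have hdom : ∀ᶠ q in 𝓝 p, xJetOf r F q ∈ E.domain := by
    refine ((contDiffOn_xJetOf hU hF r).continuousOn.continuousAt
      (hU.mem_nhds hpU)).eventually_mem (E.isOpen_domain.mem_nhds ?_)
    rw [hjet' r (by omega)]
    exact hz.1.1
  obtain ⟨δ, hδ, hball⟩ := Metric.eventually_nhds_iff_ball.1
    ((hU.eventually_mem hpU).and (hdet.and hdom))
  -- Balls of the sup metric are products, so each section is empty or an interval.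
  have hord : ∀ (t : ℝ) (φ : Fin ρ → ℝ),
      {x : ℝ | (t, x, φ) ∈ Metric.ball p δ}.OrdConnected := by
    intro t φ
    have : {x : ℝ | (t, x, φ) ∈ Metric.ball p δ} =
        {x | dist t p.1 < δ ∧ dist φ p.2.2 < δ} ∩ Metric.ball p.2.1 δ := by
      ext x
      simp only [mem_ofPred_eq, Metric.mem_ball, Prod.dist_eq, max_lt_iff, mem_inter_iff]
      tauto
    rw [this]
    refine OrdConnected.inter ⟨fun _ ha _ _ _ _ => ha⟩ ?_
    rw [Real.ball_eq_Ioo]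
    exact ordConnected_Ioo
  let A : Ansatz ρ :=
    { domain := Metric.ball p δ
      isOpen_domain := Metric.isOpen_ball
      ordConnected := hord
      F := F
      smooth := hF.mono fun q hq => (hball q hq).1
      det_ne_zero := fun q hq => (hball q hq).2.1 }
  exact ⟨A, fun q hq => hη q (hball q hq).1, fun q hq => (hball q hq).2.2,
    p, Metric.mem_ball_self hδ, hjet' (r + ρ) (by omega)⟩

end EvolutionReduction

end

theorem mainTheorem3 (r ρ : ℕ) (hr : 1 ≤ r) (hρ : 1 ≤ ρ)
    (E : EvolutionReduction.EvolutionEquation r) (Q : EvolutionReduction.ReducedField ρ) :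
    (EvolutionReduction.ConditionallyInvariant E Q ↔
      ∀ z ∈ EvolutionReduction.jointManifold E Q, ∃ A : EvolutionReduction.Ansatz ρ,
        A.ConstructedWith Q ∧ A.PassesThrough (r + ρ) z ∧ A.Reduces E) ∧
    (EvolutionReduction.ConditionallyInvariant E Q ↔
      ∀ A : EvolutionReduction.Ansatz ρ,
        A.ConstructedWith Q → A.SubstitutableIn E → A.Reduces E) ∧
    (∀ A : EvolutionReduction.Ansatz ρ, A.ConstructedWith Q → A.SubstitutableIn E →
      (A.Reduces E ↔ ∀ z ∈ EvolutionReduction.jointManifold E Q,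
        A.PassesThrough (r + ρ) z → EvolutionReduction.InvariantAt E Q z)) := by
  refine ⟨⟨fun h z hz => ?_, fun h z hz => ?_⟩, ⟨fun h A hQ hE => ?_, fun h z hz => ?_⟩,
    fun A hQ hE => EvolutionReduction.Ansatz.reduces_iff hr hρ hQ hE⟩
  · obtain ⟨A, hQ, hE, hA⟩ := EvolutionReduction.exists_ansatz hz
    exact ⟨A, hQ, hA, (EvolutionReduction.Ansatz.reduces_iff hr hρ hQ hE).2 fun z hz _ => h z hz⟩
  · obtain ⟨A, hQ, hA, hE⟩ := h z hz
    exact (EvolutionReduction.Ansatz.reduces_iff hr hρ hQ hE.1).1 hE z hz hA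
  -- The converse does need existence: the hypothesis concerns ansatzes only, and bears on a point
  -- `z` through an ansatz passing through it.
  · exact (EvolutionReduction.Ansatz.reduces_iff hr hρ hQ hE).2 fun z hz _ => h z hz
  · obtain ⟨A, hQ, hE, hA⟩ := EvolutionReduction.exists_ansatz hz
    exact (EvolutionReduction.Ansatz.reduces_iff hr hρ hQ hE).1 (h A hQ hE) z hz hA
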